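/- (Zeroth-order adiabatic theorem.) There is an absolute constant $C>0$ with the following property. Let $N$ be a natural number and, for every evolution time $T>0$, let $H=H_T:[0,1]\to\mathbb{C}^{N\times N}$ be a Hermitian-matrix-valued function (a Hamiltonian, which may depend on $T$) that is three times differentiable on $[0,1]$, the third derivative being bounded. Write $\|\dot H\|,\|\ddot H\|,\|\dddot H\|$ for the suprema over $s\in[0,1]$ of the operator norms of the first three derivatives of $H$. Let $\gamma_{\min}$ be the infimum, over $s\in[0,1]$ and over all pairs of distinct eigenvalues of $H(s)$, of the distance between the two eigenvalues, and assume $\gamma_{\min}>0$. Let $|G(s)\rangle$ be a non-degenerate instantaneous eigenstate of $H(s)$, that is, for every $s\in[0,1]$ a unit eigenvector of $H(s)$ (of arbitrary phase) for a simple eigenvalue $E_G(s)$ that depends continuously on $s$, and let $\min_{\nu,s}\gamma_{\nu,G}(s)$ be the infimum, over $s\in[0,1]$ and over the eigenvalues $E_\nu(s)\neq E_G(s)$ of $H(s)$, of $|E_\nu(s)-E_G(s)|$. Define $$\Delta_1=\frac{1}{\gamma_{\min}}\left(\frac{\|\dddot H\|}{\gamma_{\min}}+\frac{\|\ddot H\|^3}{\gamma_{\min}^3}+\frac{\|\dot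 H\|^6}{\gamma_{\min}^6}\right),\qquad \Delta_0=\frac{\|\dot H\|}{\min_{\nu,s}[\gamma_{\nu,G}(s)]^2}+\frac{\Delta_1}{\gamma_{\min}T}.$$ Let $U(s,0)$, $s\in[0,1]$, be the time-evolution operator in the dimensionless time $s=t/T$, that is, the solution of $\frac{\mathrm d}{\mathrm ds}U(s,0)=-iT\,H(s)\,U(s,0)$, $U(0,0)=\mathbb{1}$ (with $\hbar=1$), and let $P_G(1)=|G(1)\rangle\langle G(1)|$. If $\Delta_0\in o(T)$ as $T\to\infty$, then, as $T\to\infty$, $$(\mathbb{1}-P_G(1))\,U(1,0)|G(0)\rangle=O(\Delta_0/T),$$ with implied constant $C$: for all sufficiently large $T$, $\ \|(\mathbb{1}-P_G(1))\,U(1,0)|G(0)\rangle\|\le C\,\Delta_0/T$. -/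

import Mathlib

open Set Filter Asymptotics

/-- The state space `ℂ^N` with its Euclidean (Hermitian) structure. -/
abbrev QState (N : ℕ) : Type := EuclideanSpace ℂ (Fin N)

/-- Complex `N × N` matrices, viewed as operators on `ℂ^N`; the norm is the operator norm. -/
abbrev QOp (N : ℕ) : Type := QState N →L[ℂ] QState N

/-- `H` is three times differentiable on `[0,1]` (one-sidedly at the end points), with a third
derivative of bounded norm, so that `‖H⃛‖` is a finite number.  (The first two derivatives are
differentiable or continuous on the compact interval, hence bounded automatically.) -/
structure ThriceDifferentiable {N : ℕ} (H : ℝ → QOp N) : Prop where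
  differentiableOn : ∀ k : ℕ, k < 3 →
    DifferentiableOn ℝ (iteratedDerivWithin k H (Icc 0 1)) (Icc 0 1)
  bddAbove : BddAbove ((fun s => ‖iteratedDerivWithin 3 H (Icc 0 1) s‖) '' Icc 0 1)

/-- The maximum over `s ∈ [0,1]` of the norm of the `k`-th derivative of `H`. -/
noncomputable def derivMax {N : ℕ} (k : ℕ) (H : ℝ → QOp N) : ℝ :=
  sSup ((fun s => ‖iteratedDerivWithin k H (Icc 0 1) s‖) '' Icc 0 1)

/-- The real number `μ` is an eigenvalue of the operator `A`. -/
def IsEnergy {N : ℕ} (A : QOp N) (μ : ℝ) : Prop :=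
  Module.End.HasEigenvalue (A : QState N →ₗ[ℂ] QState N) (μ : ℂ)

/-- `γ_min`: the minimum over `s ∈ [0,1]` of the distances between distinct eigenvalues
of `H s`. -/
noncomputable def gapMin {N : ℕ} (H : ℝ → QOp N) : ℝ :=
  sInf {d : ℝ | ∃ s ∈ Icc (0 : ℝ) 1, ∃ μ ν : ℝ,
    IsEnergy (H s) μ ∧ IsEnergy (H s) ν ∧ μ ≠ ν ∧ d = |μ - ν|}

/-- `min_{ν,s} γ_{ν,G}(s)`: the minimum over `s ∈ [0,1]` of the distances from `E s` to the other
eigenvalues of `H s`. -/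
noncomputable def gapFrom {N : ℕ} (H : ℝ → QOp N) (E : ℝ → ℝ) : ℝ :=
  sInf {d : ℝ | ∃ s ∈ Icc (0 : ℝ) 1, ∃ μ : ℝ, IsEnergy (H s) μ ∧ μ ≠ E s ∧ d = |μ - E s|}

/-- The timescale `Δ₁`. -/
noncomputable def timescale₁ {N : ℕ} (H : ℝ → QOp N) : ℝ :=
  1 / gapMin H * (derivMax 3 H / gapMin H + derivMax 2 H ^ 3 / gapMin H ^ 3
    + derivMax 1 H ^ 6 / gapMin H ^ 6)

/-- The timescale `Δ₀`, for the evolution time `T` and the energy branch `E`. -/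
noncomputable def timescale₀ {N : ℕ} (T : ℝ) (H : ℝ → QOp N) (E : ℝ → ℝ) : ℝ :=
  derivMax 1 H / gapFrom H E ^ 2 + timescale₁ H / (gapMin H * T)

/-- `G s` is a normalized, non-degenerate instantaneous eigenstate of `H s`, with energy `E s`,
for every `s ∈ [0,1]`; the energy `E` is a continuous branch.  The phase of `G s` is arbitrary. -/
structure IsNondegenerateEigenstate {N : ℕ} (H : ℝ → QOp N) (E : ℝ → ℝ) (G : ℝ → QState N) :
    Prop where
  continuousOn : ContinuousOn E (Icc 0 1)
  norm_eq_one : ∀ s ∈ Icc (0 : ℝ) 1, ‖G s‖ = 1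
  apply_eq : ∀ s ∈ Icc (0 : ℝ) 1, H s (G s) = (E s : ℂ) • G s
  nondegenerate : ∀ s ∈ Icc (0 : ℝ) 1,
    Module.finrank ℂ (Module.End.eigenspace (H s : QState N →ₗ[ℂ] QState N) (E s : ℂ)) = 1

/-- `U s` is the time-evolution operator `U(s,0)` in the dimensionless time `s = t/T`: the
solution on `[0,1]` of the Schrödinger equation `i U' = T H U` (with `ħ = 1`), `U 0 = 1`. -/
structure IsEvolution {N : ℕ} (T : ℝ) (H U : ℝ → QOp N) : Prop where
  init : U 0 = 1
  hasDeriv : ∀ s ∈ Icc (0 : ℝ) 1,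
    HasDerivWithinAt U (-(Complex.I * (T : ℂ)) • (H s * U s)) (Icc 0 1) s

/-- The projector `P_G(s) = |G(s)⟩⟨G(s)|`, for a unit vector `g = G(s)`. -/
noncomputable def stateProj {N : ℕ} (g : QState N) : QOp N :=
  InnerProductSpace.rankOne ℂ g g

/-- The error in the adiabatic approximation, `(1 - P_G(1)) U(1,0) |G(0)⟩`. -/
noncomputable def adiabaticError {N : ℕ} (U : ℝ → QOp N) (G : ℝ → QState N) : QState N :=
  (1 - stateProj (G 1)) (U 1 (G 0))

/-- Terms of the Dyson series for `U' = A U`. -/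
noncomputable def dysonTerm {N : ℕ} (A : ℝ → QOp N) : ℕ → ℝ → QOp N
  | 0 => fun _ => 1
  | n + 1 => fun s => ∫ t in (0 : ℝ)..s, A t * dysonTerm A n t

theorem dysonTerm_continuous {N : ℕ} {A : ℝ → QOp N} (hA : Continuous A) (n : ℕ) :
    Continuous (dysonTerm A n) := by
  induction n with
  | zero => exact continuous_const
  | succ n ih =>
    have h : Continuous fun t => A t * dysonTerm A n t := hA.mul ih
    exact intervalIntegral.continuous_primitive (fun a b => h.intervalIntegrable a b) 0

theorem dysonTerm_hasDerivAt {N : ℕ} {A : ℝ → QOp N} (hA : Continuous A) (n : ℕ) (s : ℝ) :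
    HasDerivAt (dysonTerm A (n + 1)) (A s * dysonTerm A n s) s := by
  have h : Continuous fun t => A t * dysonTerm A n t := hA.mul (dysonTerm_continuous hA n)
  exact intervalIntegral.integral_hasDerivAt_right (h.intervalIntegrable 0 s)
    h.stronglyMeasurable.stronglyMeasurableAtFilter h.continuousAt

theorem dysonTerm_norm_le {N : ℕ} {A : ℝ → QOp N} {K : ℝ} (hA : Continuous A)
    (hK0 : 0 ≤ K) (hK : ∀ t, ‖A t‖ ≤ K) (n : ℕ) (s : ℝ) :
    ‖dysonTerm A n s‖ ≤ (K * |s|) ^ n / (n.factorial : ℝ) := by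
  induction n generalizing s with
  | zero =>
    have h1 : ‖(1 : QOp N)‖ ≤ 1 := ContinuousLinearMap.norm_id_le
    simpa [dysonTerm] using h1
  | succ n ih =>
    have h : Continuous fun t => A t * dysonTerm A n t := hA.mul (dysonTerm_continuous hA n)
    have hb : ∀ t, ‖A t * dysonTerm A n t‖ ≤ K ^ (n + 1) / (n.factorial : ℝ) * |t - 0| ^ n := by
      intro t
      calc ‖A t * dysonTerm A n t‖ ≤ ‖A t‖ * ‖dysonTerm A n t‖ := norm_mul_le _ _
        _ ≤ K * ((K * |t|) ^ n / (n.factorial : ℝ)) :=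
          mul_le_mul (hK t) (ih t) (norm_nonneg _) hK0
        _ = _ := by rw [sub_zero, mul_pow]; ring
    have hg : Continuous fun t : ℝ => K ^ (n + 1) / (n.factorial : ℝ) * |t - 0| ^ n := by fun_prop
    calc ‖dysonTerm A (n + 1) s‖ ≤ ∫ t in Set.uIoc 0 s, ‖A t * dysonTerm A n t‖ :=
          intervalIntegral.norm_integral_le_integral_norm_uIoc
      _ ≤ ∫ t in Set.uIoc 0 s, K ^ (n + 1) / (n.factorial : ℝ) * |t - 0| ^ n :=
          MeasureTheory.setIntegral_mono (h.norm.integrableOn_uIoc) (hg.integrableOn_uIoc) hb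
      _ = _ := by
          rw [MeasureTheory.integral_const_mul, integral_pow_abs_sub_uIoc, sub_zero,
            Nat.factorial_succ, mul_pow]
          push_cast
          field_simp

/-- The time-evolution operator exists, for every Hamiltonian that is continuous on `[0,1]`. -/
theorem exists_isEvolution {N : ℕ} (T : ℝ) (H : ℝ → QOp N) (hH : ContinuousOn H (Icc 0 1)) :
    ∃ U : ℝ → QOp N, IsEvolution T H U := by
  set A : ℝ → QOp N := fun t =>
    -(Complex.I * (T : ℂ)) • H (Set.projIcc (0 : ℝ) 1 zero_le_one t) with hAdef
  have hc : Continuous fun t : ℝ => H (Set.projIcc (0 : ℝ) 1 zero_le_one t) :=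
    (continuousOn_iff_continuous_domRestrict.mp hH).comp continuous_projIcc
  have hA : Continuous A := hc.const_smul (-(Complex.I * (T : ℂ)))
  obtain ⟨M, hM⟩ := isCompact_Icc.exists_bound_of_continuousOn hH
  set K : ℝ := ‖-(Complex.I * (T : ℂ))‖ * |M| with hKdef
  have hK0 : 0 ≤ K := by positivity
  have hK : ∀ t, ‖A t‖ ≤ K := by
    intro t
    rw [hAdef, norm_smul]
    exact mul_le_mul_of_nonneg_left
      ((hM _ (Set.projIcc (0 : ℝ) 1 zero_le_one t).2).trans (le_abs_self M)) (norm_nonneg _)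
  have hsum : Summable fun n : ℕ => (K * 2) ^ n / (n.factorial : ℝ) :=
    Real.summable_pow_div_factorial _
  have hbd : ∀ n : ℕ, ∀ s ∈ Ioo (-1 : ℝ) 2,
      ‖dysonTerm A n s‖ ≤ (K * 2) ^ n / (n.factorial : ℝ) := by
    intro n s hs
    refine (dysonTerm_norm_le hA hK0 hK n s).trans ?_
    have : |s| ≤ 2 := abs_le.mpr ⟨by linarith [hs.1], hs.2.le⟩
    gcongr
  have h0 : (0 : ℝ) ∈ Ioo (-1 : ℝ) 2 := by constructor <;> norm_num
  have hs : ∀ s ∈ Ioo (-1 : ℝ) 2, Summable fun n => dysonTerm A n s := fun s hs' =>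
    Summable.of_norm_bounded hsum fun n => hbd n s hs'
  have hval : ∀ n, dysonTerm A (n + 1) 0 = 0 := fun n => intervalIntegral.integral_same
  have hder : ∀ s ∈ Ioo (-1 : ℝ) 2, HasDerivAt (fun s => ∑' n, dysonTerm A (n + 1) s)
      (∑' n, A s * dysonTerm A n s) s := by
    intro s hs'
    have hg0 : Summable fun n => dysonTerm A (n + 1) 0 := by simp only [hval]; exact summable_zero
    have hu : Summable fun n : ℕ => K * ((K * 2) ^ n / (n.factorial : ℝ)) := hsum.mul_left K
    have hg' : ∀ (n : ℕ) (y : ℝ), y ∈ Ioo (-1 : ℝ) 2 →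
        ‖A y * dysonTerm A n y‖ ≤ K * ((K * 2) ^ n / (n.factorial : ℝ)) := fun n y hy =>
      (norm_mul_le _ _).trans (mul_le_mul (hK y) (hbd n y hy) (norm_nonneg _) hK0)
    exact hasDerivAt_tsum_of_isPreconnected (g := fun n s => dysonTerm A (n + 1) s)
      (g' := fun n s => A s * dysonTerm A n s) hu isOpen_Ioo isPreconnected_Ioo
      (fun n y _ => dysonTerm_hasDerivAt hA n y) hg' h0 hg0 hs'
  refine ⟨fun s => 1 + ∑' n, dysonTerm A (n + 1) s, by simp [hval], ?_⟩
  intro s hs'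
  have hsI : s ∈ Ioo (-1 : ℝ) 2 := ⟨by linarith [hs'.1], by linarith [hs'.2]⟩
  have e1 : (1 : QOp N) + ∑' n, dysonTerm A (n + 1) s = ∑' n, dysonTerm A n s :=
    ((hs s hsI).tsum_eq_zero_add).symm
  have e2 : ∑' n, A s * dysonTerm A n s = A s * ∑' n, dysonTerm A n s :=
    (hs s hsI).tsum_mul_left _
  have e3 : A s = -(Complex.I * (T : ℂ)) • H s := by
    rw [hAdef]
    simp only [Set.projIcc_of_mem zero_le_one hs']
  have := ((hder s hsI).const_add (1 : QOp N)).hasDerivWithinAt (s := Icc 0 1)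
  rw [e2, e3, ← e1, smul_mul_assoc] at this
  exact this

/-! Measure energy in units of the gap `γ` around `E`, so that the gap becomes 1 and `T` becomes
`γT`. Let `P` be the eigenprojection, `R` the inverse of `H - E + P` (norm at most 1), and `S = R -
P` the reduced resolvent. Perturbation theory gives `P' = -(S H' P + P H' S)`. The range of `P` is
not exactly transported by the evolution, but that of a nearby family is, up to order `T⁻²`. Put `F
= P - (i/T) V + T⁻² W`, where `[H, V] = -P'` and `[H, W] = V'`; both equations are solved explicitly
with `S`. Then `F' + iT [H, F] = T⁻² W'`, so `U* F U` moves by at most `T⁻² sup ‖W'‖`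
(`norm_conj_sub_le`). Since `F - P` is of order `1/T`, the leakage `(1 - P(1)) U(1) P(0)` is small
too (`IsEvolution.norm_leakage_le`, `exists_superadiabatic`). With `a, b, d` bounding the first
three derivatives of `H`, absolute constants require `‖W‖ ≲ a² + b` and `‖W'‖ ≲ a³ + ab + d`. These
follow from weighted jets: the derivatives of `P`, `R` and `E` are polynomials in `P`, `R`, `H'` and
`E'`, so bounds climb one order at a time. Landau's inequality replaces `b` by `min b (4a + d)`,
after which the error is absorbed into `a/T + (d + b³ + a⁶)/T²` (`jetWeight_absorb`). Undoing the
rescaling gives the two terms of `Δ₀/T`. -/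

/-! ### Weighted jets of operator families. -/

/-- On `[0,1]` the function `f` is `n` times differentiable, and its derivative of order `i ≤ n`
is bounded by `c * w (j + i)`. -/
def JetBound {N : ℕ} (w : ℕ → ℝ) (c : ℝ) : ℕ → ℕ → (ℝ → QOp N) → Prop
  | 0, j, f => ∀ s ∈ Icc (0 : ℝ) 1, ‖f s‖ ≤ c * w j
  | n + 1, j, f => (∀ s ∈ Icc (0 : ℝ) 1, ‖f s‖ ≤ c * w j) ∧
      ∃ f' : ℝ → QOp N, (∀ s ∈ Icc (0 : ℝ) 1, HasDerivWithinAt f (f' s) (Icc 0 1) s) ∧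
        JetBound w c n (j + 1) f'

namespace JetBound

variable {N : ℕ} {w : ℕ → ℝ} {c d : ℝ} {n j k : ℕ} {f g : ℝ → QOp N}

theorem bound (h : JetBound w c n j f) : ∀ s ∈ Icc (0 : ℝ) 1, ‖f s‖ ≤ c * w j := by
  cases n with
  | zero => exact h
  | succ n => exact h.1

theorem of_succ (h : JetBound w c (n + 1) j f) : JetBound w c n j f := by
  induction n generalizing j f with
  | zero => exact h.1
  | succ n ih =>
    obtain ⟨h0, f', hf, h1⟩ := h
    exact ⟨h0, f', hf, ih h1⟩

theorem mono (hw : ∀ i, 0 ≤ w i) (hcd : c ≤ d) (h : JetBound w c n j f) : JetBound w d n j f := by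
  induction n generalizing j f with
  | zero => exact fun s hs => (h s hs).trans (mul_le_mul_of_nonneg_right hcd (hw j))
  | succ n ih =>
    obtain ⟨h0, f', hf, h1⟩ := h
    exact ⟨fun s hs => (h0 s hs).trans (mul_le_mul_of_nonneg_right hcd (hw j)), f', hf, ih h1⟩

/-- This is how regularity is gained: an `n`-jet of a formula for `f'` becomes an `(n + 1)`-jet of
`f`. -/
theorem cons (hw : ∀ i, 0 ≤ w i) {f' : ℝ → QOp N} (h0 : JetBound w c 0 j f)
    (hf : ∀ s ∈ Icc (0 : ℝ) 1, HasDerivWithinAt f (f' s) (Icc 0 1) s)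
    (h1 : JetBound w d n (j + 1) f') : JetBound w (max c d) (n + 1) j f :=
  ⟨(h0.mono hw (le_max_left c d)).bound, f', hf, h1.mono hw (le_max_right c d)⟩

theorem add (hf : JetBound w c n j f) (hg : JetBound w d n j g) :
    JetBound w (c + d) n j (fun s => f s + g s) := by
  have key : ∀ s ∈ Icc (0 : ℝ) 1, ‖f s + g s‖ ≤ (c + d) * w j := fun s hs => by
    rw [add_mul]
    exact (norm_add_le _ _).trans (add_le_add (hf.bound s hs) (hg.bound s hs))
  induction n generalizing j f g with
  | zero => exact key
  | succ n ih =>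
    obtain ⟨_, f', hf', hf1⟩ := hf
    obtain ⟨_, g', hg', hg1⟩ := hg
    refine ⟨key, fun s => f' s + g' s, fun s hs => (hf' s hs).add (hg' s hs), ih hf1 hg1 ?_⟩
    intro s hs
    rw [add_mul]
    exact (norm_add_le _ _).trans (add_le_add (hf1.bound s hs) (hg1.bound s hs))

theorem neg (hf : JetBound w c n j f) : JetBound w c n j (fun s => -f s) := by
  induction n generalizing j f with
  | zero => exact fun s hs => by rw [norm_neg]; exact hf s hs
  | succ n ih =>
    obtain ⟨h0, f', hf', hf1⟩ := hf
    exact ⟨fun s hs => by rw [norm_neg]; exact h0 s hs, fun s => -f' s,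
      fun s hs => (hf' s hs).neg, ih hf1⟩

theorem sub (hf : JetBound w c n j f) (hg : JetBound w d n j g) :
    JetBound w (c + d) n j (fun s => f s - g s) := by
  simpa only [sub_eq_add_neg] using hf.add hg.neg

/-- Leibniz' rule yields `2 ^ n` terms at order `n`, and submultiplicativity of the weights bounds
each one. Only total order at most 3 is needed, and `jetWeight` is graded only that far. -/
theorem mul (hw : ∀ i, 0 ≤ w i) (hww : ∀ i l, i + l ≤ 3 → w i * w l ≤ w (i + l))
    (hc : 0 ≤ c) (hd : 0 ≤ d) (hn : n + j + k ≤ 3)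
    (hf : JetBound w c n j f) (hg : JetBound w d n k g) :
    JetBound w (2 ^ n * (c * d)) n (j + k) (fun s => f s * g s) := by
  have key : ∀ s ∈ Icc (0 : ℝ) 1, ‖f s * g s‖ ≤ c * d * w (j + k) := fun s hs =>
    calc ‖f s * g s‖ ≤ ‖f s‖ * ‖g s‖ := norm_mul_le _ _
      _ ≤ (c * w j) * (d * w k) := mul_le_mul (hf.bound s hs) (hg.bound s hs) (norm_nonneg _)
          (mul_nonneg hc (hw j))
      _ = c * d * (w j * w k) := by ring
      _ ≤ c * d * w (j + k) := mul_le_mul_of_nonneg_left (hww j k (by lia)) (mul_nonneg hc hd)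
  induction n generalizing j k f g with
  | zero => intro s hs; simpa using key s hs
  | succ n ih =>
    have hf0 := hf.of_succ
    have hg0 := hg.of_succ
    obtain ⟨_, f', hf', hf1⟩ := hf
    obtain ⟨_, g', hg', hg1⟩ := hg
    refine ⟨fun s hs => (key s hs).trans (mul_le_mul_of_nonneg_right
      (le_mul_of_one_le_left (mul_nonneg hc hd) (one_le_pow₀ one_le_two)) (hw _)),
      fun s => f' s * g s + f s * g' s, fun s hs => (hf' s hs).mul (hg' s hs), ?_⟩
    -- The bound `key` depends on `f` and `g`, so the induction hypothesis has it as a premise;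
    -- `aux` supplies it for both Leibniz terms.
    have aux : ∀ {p q : ℕ} {u v : ℝ → QOp N}, n + p + q ≤ 3 → JetBound w c n p u →
        JetBound w d n q v → ∀ s ∈ Icc (0 : ℝ) 1, ‖u s * v s‖ ≤ c * d * w (p + q) :=
      fun {p q u v} hpq hu hv s hs =>
      calc ‖u s * v s‖ ≤ ‖u s‖ * ‖v s‖ := norm_mul_le _ _
        _ ≤ (c * w p) * (d * w q) := mul_le_mul (hu.bound s hs) (hv.bound s hs) (norm_nonneg _)
            (mul_nonneg hc (hw p))
        _ = c * d * (w p * w q) := by ring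
        _ ≤ c * d * w (p + q) := mul_le_mul_of_nonneg_left (hww p q (by lia)) (mul_nonneg hc hd)
    have h1 := ih (by lia) hf1 hg0 (aux (by lia) hf1 hg0)
    have h2 := ih (by lia) hf0 hg1 (aux (by lia) hf0 hg1)
    have e1 : j + 1 + k = j + k + 1 := by lia
    have e2 : j + (k + 1) = j + k + 1 := by lia
    rw [e1] at h1
    rw [e2] at h2
    have h3 := h1.add h2
    rwa [← two_mul, ← mul_assoc, ← pow_succ'] at h3

end JetBound

/-! ### Differentiating coefficients and inverses. -/

theorem hasDerivWithinAt_re_inner_apply {N : ℕ} {F : ℝ → QOp N} {F' : QOp N} {t : ℝ} {I : Set ℝ}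
    (hF : HasDerivWithinAt F F' I t) (x : QState N) :
    HasDerivWithinAt (fun s => (inner ℂ x (F s x)).re) (inner ℂ x (F' x)).re I t := by
  have h := ((Complex.reCLM.comp ((innerSL ℂ x).restrictScalars ℝ)).comp
    ((ContinuousLinearMap.apply ℂ (QState N) x).restrictScalars ℝ)).hasFDerivAt
      (x := F t) |>.comp_hasDerivWithinAt t hF
  exact h

theorem re_inner_apply_le {N : ℕ} (F : QOp N) {x : QState N} (hx : ‖x‖ = 1) :
    |(inner ℂ x (F x)).re| ≤ ‖F‖ := by
  calc |(inner ℂ x (F x)).re| ≤ ‖inner ℂ x (F x)‖ := Complex.abs_re_le_norm _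
    _ ≤ ‖x‖ * ‖F x‖ := norm_inner_le_norm _ _
    _ ≤ ‖F‖ := by
      have := F.le_opNorm x
      rw [hx] at this ⊢
      linarith

theorem norm_stateProj {N : ℕ} {g : QState N} (hg : ‖g‖ = 1) : ‖stateProj g‖ = 1 := by
  simp [stateProj, hg]

theorem stateProj_mul_self {N : ℕ} {g : QState N} (hg : ‖g‖ = 1) :
    stateProj g * stateProj g = stateProj g :=
  InnerProductSpace.isIdempotentElem_rankOne_self hg

theorem stateProj_apply_self {N : ℕ} {g : QState N} (hg : ‖g‖ = 1) : stateProj g g = g := by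
  simp [stateProj, hg, inner_self_eq_norm_sq_to_K]

theorem inner_stateProj_apply {N : ℕ} {g : QState N} (hg : ‖g‖ = 1) (x : QState N) :
    inner ℂ g (stateProj g x) = inner ℂ g x := by
  simp [stateProj, hg, inner_self_eq_norm_sq_to_K]

/-- A scalar coefficient of a differentiable family of rank-one projections is differentiable. -/
theorem exists_hasDerivWithinAt_of_smul_proj {N : ℕ} {P F : ℝ → QOp N} {P' F' : QOp N} {e : ℝ → ℝ}
    {t : ℝ} {I : Set ℝ} (ht : t ∈ I) {g : QState N} (hg : ‖g‖ = 1) (hPt : P t = stateProj g)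
    (hP : HasDerivWithinAt P P' I t) (hP' : P t * P' * P t = 0)
    (hF : HasDerivWithinAt F F' I t) (he : ∀ s ∈ I, (e s : ℂ) • P s = F s) :
    ∃ e' : ℝ, HasDerivWithinAt e e' I t ∧ |e'| ≤ ‖F'‖ := by
  refine ⟨(inner ℂ g (F' g)).re, ?_, re_inner_apply_le F' hg⟩
  have hu := hasDerivWithinAt_re_inner_apply hF g
  have hv := hasDerivWithinAt_re_inner_apply hP g
  have hv1 : (inner ℂ g (P t g)).re = 1 := by
    rw [hPt, stateProj_apply_self hg, inner_self_eq_norm_sq_to_K, hg]; simp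
  have hv0 : (inner ℂ g (P' g)).re = 0 := by
    have : inner ℂ g ((P t * P' * P t) g) = inner ℂ g (P' g) := by
      change inner ℂ g (P t (P' (P t g))) = _
      rw [hPt, stateProj_apply_self hg, inner_stateProj_apply hg]
    rw [← this, hP']
    simp
  have huv : ∀ s ∈ I, e s * (inner ℂ g (P s g)).re = (inner ℂ g (F s g)).re := by
    intro s hs
    rw [← he s hs]
    simp
  have hev : ∀ᶠ s in nhdsWithin t I, (inner ℂ g (P s g)).re ≠ 0 :=
    hv.continuousWithinAt.eventually_ne (by simp only [hv1]; exact one_ne_zero)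
  -- Near `t`, `e` is the quotient of the expectations of `F` and `P` in `g`. The denominator has
  -- value 1 and derivative 0 at `t`, so only the numerator contributes.
  have hd := hu.div hv (by rw [hv1]; exact one_ne_zero)
  rw [hv1, hv0] at hd
  simp only [mul_one, mul_zero, sub_zero, one_pow, div_one] at hd
  refine hd.congr_of_eventuallyEq ?_ ?_
  · filter_upwards [hev, self_mem_nhdsWithin] with s hs hsI
    simp only [Pi.div_apply]
    rw [← huv s hsI]
    field_simp
  · simp only [Pi.div_apply]
    rw [← huv t ht, hv1]
    simp

/-- The inverse of a differentiable family of operators is differentiable. -/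
theorem hasDerivWithinAt_opInverse {N : ℕ} {M R : ℝ → QOp N} {M' : QOp N} {t : ℝ} {I : Set ℝ}
    (ht : t ∈ I) (hM : HasDerivWithinAt M M' I t) (hRM : ∀ s ∈ I, R s * M s = 1)
    (hMR : ∀ s ∈ I, M s * R s = 1) :
    HasDerivWithinAt R (-(R t * M' * R t)) I t := by
  let u : (QOp N)ˣ := ⟨M t, R t, hMR t ht, hRM t ht⟩
  have h : HasDerivWithinAt (fun s => Ring.inverse (M s)) (-(R t * M' * R t)) I t := by
    have h1 := (hasFDerivAt_ringInverse (𝕜 := ℝ) u).comp_hasDerivWithinAt_of_eq t hM rfl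
    simpa [Function.comp_def, u] using h1
  have hR : ∀ s ∈ I, R s = Ring.inverse (M s) := fun s hs =>
    (Ring.inverse_unit (⟨M s, R s, hMR s hs, hRM s hs⟩ : (QOp N)ˣ)).symm
  exact h.congr hR (hR t ht)

theorem proj_mul_offDiag_mul_proj {A : Type*} [Ring A] {P S X : A} (hPS : P * S = 0)
    (hSP : S * P = 0) : P * -(S * X * P + P * X * S) * P = 0 := by
  have h : P * -(S * X * P + P * X * S) * P = -((P * S) * X * P * P + P * P * X * (S * P)) := by
    noncomm_ring
  rw [h, hPS, hSP]
  simp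

/-! ### Spectral data of a unit-gap family and their jets. -/

/-- A thrice differentiable Hamiltonian `H` with derivatives `H₁, H₂, H₃`, its simple eigenvalue
`E` with derivative `e` and eigenprojection `P`, and the inverse `R` of `H - E + P`. -/
structure GappedFamily {N : ℕ} (a b d : ℝ) (H H₁ H₂ H₃ P R : ℝ → QOp N) (E e : ℝ → ℝ) :
    Prop where
  deriv₀ : ∀ s ∈ Icc (0 : ℝ) 1, HasDerivWithinAt H (H₁ s) (Icc 0 1) s
  deriv₁ : ∀ s ∈ Icc (0 : ℝ) 1, HasDerivWithinAt H₁ (H₂ s) (Icc 0 1) s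
  deriv₂ : ∀ s ∈ Icc (0 : ℝ) 1, HasDerivWithinAt H₂ (H₃ s) (Icc 0 1) s
  bound₁ : ∀ s ∈ Icc (0 : ℝ) 1, ‖H₁ s‖ ≤ a
  bound₂ : ∀ s ∈ Icc (0 : ℝ) 1, ‖H₂ s‖ ≤ b
  bound₃ : ∀ s ∈ Icc (0 : ℝ) 1, ‖H₃ s‖ ≤ d
  proj : ∀ s ∈ Icc (0 : ℝ) 1, ∃ g : QState N, ‖g‖ = 1 ∧ P s = stateProj g
  mul_proj : ∀ s ∈ Icc (0 : ℝ) 1, H s * P s = (E s : ℂ) • P s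
  proj_mul : ∀ s ∈ Icc (0 : ℝ) 1, P s * H s = (E s : ℂ) • P s
  inv_mul : ∀ s ∈ Icc (0 : ℝ) 1, R s * (H s - (E s : ℂ) • 1 + P s) = 1
  mul_inv : ∀ s ∈ Icc (0 : ℝ) 1, (H s - (E s : ℂ) • 1 + P s) * R s = 1
  bound_inv : ∀ s ∈ Icc (0 : ℝ) 1, ‖R s‖ ≤ 1
  deriv_E : ∀ s ∈ Icc (0 : ℝ) 1, HasDerivWithinAt E (e s) (Icc 0 1) s
  bound_e : ∀ s ∈ Icc (0 : ℝ) 1, |e s| ≤ a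
  smul_proj : ∀ s ∈ Icc (0 : ℝ) 1, (e s : ℂ) • P s = P s * H₁ s * P s
  deriv_P : ∀ s ∈ Icc (0 : ℝ) 1, HasDerivWithinAt P
    (-((R s - P s) * H₁ s * P s + P s * H₁ s * (R s - P s))) (Icc 0 1) s

/-- The sizes of the derivatives of the spectral data, by order. -/
def jetWeight (a b d : ℝ) : ℕ → ℝ
  | 0 => 1
  | 1 => a
  | 2 => a ^ 2 + b
  | _ => a ^ 3 + a * b + d

theorem jetWeight_nonneg {a b d : ℝ} (ha : 0 ≤ a) (hb : 0 ≤ b) (hd : 0 ≤ d) (i : ℕ) :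
    0 ≤ jetWeight a b d i := by
  rcases i with _ | _ | _ | i <;> simp only [jetWeight] <;> positivity

/-- If `a`, `b`, `d` count as orders 1, 2, 3, every monomial produced by a product of weights
already occurs in the weight of the total order. -/
theorem jetWeight_mul_le {a b d : ℝ} (ha : 0 ≤ a) (hb : 0 ≤ b) (hd : 0 ≤ d) (i l : ℕ)
    (h : i + l ≤ 3) : jetWeight a b d i * jetWeight a b d l ≤ jetWeight a b d (i + l) := by
  have hab := mul_nonneg ha hb
  rcases i with _ | _ | _ | _ | i <;> rcases l with _ | _ | _ | _ | l <;>
    first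
    | (exfalso; lia)
    | (simp only [jetWeight, Nat.zero_add, Nat.add_zero, Nat.reduceAdd]; nlinarith)

namespace GappedFamily

variable {N : ℕ} {a b d : ℝ} {H H₁ H₂ H₃ P R : ℝ → QOp N} {E e : ℝ → ℝ}

theorem proj_sq (h : GappedFamily a b d H H₁ H₂ H₃ P R E e) {s : ℝ} (hs : s ∈ Icc (0 : ℝ) 1) :
    P s * P s = P s := by
  obtain ⟨g, hg, hP⟩ := h.proj s hs
  rw [hP, stateProj_mul_self hg]

theorem norm_proj (h : GappedFamily a b d H H₁ H₂ H₃ P R E e) {s : ℝ} (hs : s ∈ Icc (0 : ℝ) 1) :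
    ‖P s‖ = 1 := by
  obtain ⟨g, hg, hP⟩ := h.proj s hs
  rw [hP, norm_stateProj hg]

/-- On the range of `P` the operator `H - E + P` is the identity, hence so is its inverse. Thus `R -
P` kills that range and inverts `H - E` on the complement. -/
theorem inv_proj (h : GappedFamily a b d H H₁ H₂ H₃ P R E e) {s : ℝ} (hs : s ∈ Icc (0 : ℝ) 1) :
    R s * P s = P s := by
  have h1 : (H s - (E s : ℂ) • 1 + P s) * P s = P s := by
    rw [add_mul, sub_mul, h.mul_proj s hs, h.proj_sq hs, smul_mul_assoc, one_mul, sub_self,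
      zero_add]
  calc R s * P s = R s * ((H s - (E s : ℂ) • 1 + P s) * P s) := by rw [h1]
    _ = P s := by rw [← mul_assoc, h.inv_mul s hs, one_mul]

theorem proj_inv (h : GappedFamily a b d H H₁ H₂ H₃ P R E e) {s : ℝ} (hs : s ∈ Icc (0 : ℝ) 1) :
    P s * R s = P s := by
  have h1 : P s * (H s - (E s : ℂ) • 1 + P s) = P s := by
    rw [mul_add, mul_sub, h.proj_mul s hs, h.proj_sq hs, mul_smul_comm, mul_one, sub_self,
      zero_add]
  calc P s * R s = (P s * (H s - (E s : ℂ) • 1 + P s)) * R s := by rw [h1]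
    _ = P s := by rw [mul_assoc, h.mul_inv s hs, mul_one]

theorem deriv_inv (h : GappedFamily a b d H H₁ H₂ H₃ P R E e) {s : ℝ} (hs : s ∈ Icc (0 : ℝ) 1) :
    HasDerivWithinAt R (-(R s * (H₁ s - (e s : ℂ) • 1 +
      -((R s - P s) * H₁ s * P s + P s * H₁ s * (R s - P s))) * R s)) (Icc 0 1) s := by
  have hE : HasDerivWithinAt (fun s => (E s : ℂ) • (1 : QOp N)) ((e s : ℂ) • 1) (Icc 0 1) s :=
    (h.deriv_E s hs).ofReal_comp.smul_const (1 : QOp N)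
  exact hasDerivWithinAt_opInverse hs (((h.deriv₀ s hs).sub hE).add (h.deriv_P s hs))
    h.inv_mul h.mul_inv

theorem nonneg (h : GappedFamily a b d H H₁ H₂ H₃ P R E e) : 0 ≤ a ∧ 0 ≤ b ∧ 0 ≤ d :=
  have h0 : (0 : ℝ) ∈ Icc (0 : ℝ) 1 := ⟨le_rfl, zero_le_one⟩
  ⟨(norm_nonneg _).trans (h.bound₁ 0 h0), (norm_nonneg _).trans (h.bound₂ 0 h0),
    (norm_nonneg _).trans (h.bound₃ 0 h0)⟩

theorem weight_nonneg (h : GappedFamily a b d H H₁ H₂ H₃ P R E e) (i : ℕ) :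
    0 ≤ jetWeight a b d i :=
  jetWeight_nonneg h.nonneg.1 h.nonneg.2.1 h.nonneg.2.2 i

/-- The free bound `z` lets constants be rounded to short numerals, and the default arguments
discharge the numerical side conditions. -/
theorem jet_mul (h : GappedFamily a b d H H₁ H₂ H₃ P R E e) {x y z : ℝ} {n j k : ℕ}
    {f g : ℝ → QOp N} (hf : JetBound (jetWeight a b d) x n j f)
    (hg : JetBound (jetWeight a b d) y n k g)
    (hx : 0 ≤ x := by norm_num) (hy : 0 ≤ y := by norm_num) (hn : n + j + k ≤ 3 := by norm_num)
    (hz : 2 ^ n * (x * y) ≤ z := by norm_num) :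
    JetBound (jetWeight a b d) z n (j + k) (fun s => f s * g s) :=
  (JetBound.mul h.weight_nonneg (jetWeight_mul_le h.nonneg.1 h.nonneg.2.1 h.nonneg.2.2) hx hy hn
    hf hg).mono h.weight_nonneg hz

theorem jet_H₁ (h : GappedFamily a b d H H₁ H₂ H₃ P R E e) :
    JetBound (jetWeight a b d) 1 2 1 H₁ := by
  obtain ⟨ha, hb, hd⟩ := h.nonneg
  refine ⟨fun s hs => ?_, H₂, h.deriv₁, fun s hs => ?_, H₃, h.deriv₂, fun s hs => ?_⟩
  · simpa [jetWeight] using h.bound₁ s hs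
  · refine (h.bound₂ s hs).trans ?_
    simp only [jetWeight]
    nlinarith
  · refine (h.bound₃ s hs).trans ?_
    simp only [jetWeight]
    have : 0 ≤ a ^ 3 + a * b := by positivity
    linarith

theorem jet_P_zero (h : GappedFamily a b d H H₁ H₂ H₃ P R E e) :
    JetBound (jetWeight a b d) 1 0 0 P := fun s hs => by
  simp [jetWeight, h.norm_proj hs]

theorem jet_R_zero (h : GappedFamily a b d H H₁ H₂ H₃ P R E e) :
    JetBound (jetWeight a b d) 1 0 0 R := fun s hs => by
  simpa [jetWeight] using h.bound_inv s hs

theorem jet_e_zero (h : GappedFamily a b d H H₁ H₂ H₃ P R E e) :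
    JetBound (jetWeight a b d) 1 0 1 (fun s => (e s : ℂ) • (1 : QOp N)) := fun s hs => by
  have h1 : ‖(1 : QOp N)‖ ≤ 1 := ContinuousLinearMap.norm_id_le
  have h2 := h.bound_e s hs
  rw [norm_smul, Complex.norm_real, Real.norm_eq_abs]
  simp only [jetWeight]
  nlinarith [abs_nonneg (e s), norm_nonneg (1 : QOp N)]

/-- The derivative of the projection inherits the jets of the projection and the inverse. -/
theorem jet_derivP (h : GappedFamily a b d H H₁ H₂ H₃ P R E e) {n : ℕ} {x y : ℝ} (hn : n ≤ 2)
    (hx : 0 ≤ x) (hy : 0 ≤ y) (hP : JetBound (jetWeight a b d) x n 0 P)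
    (hR : JetBound (jetWeight a b d) y n 0 R)
    (hH : JetBound (jetWeight a b d) 1 n 1 H₁) :
    JetBound (jetWeight a b d) (2 * (2 ^ n * (2 ^ n * (y + x) * x))) n 1
      (fun s => -((R s - P s) * H₁ s * P s + P s * H₁ s * (R s - P s))) := by
  have hS := hR.sub hP
  have h1 := h.jet_mul (h.jet_mul (z := 2 ^ n * (y + x)) hS hH (by positivity) (by positivity)
    (by lia) (by simp)) hP (by positivity) (by positivity) (by lia) le_rfl
  have h2 := h.jet_mul (h.jet_mul (z := 2 ^ n * x) hP hH (by positivity) (by positivity)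
    (by lia) (by simp)) hS (by positivity) (by positivity) (by lia) le_rfl
  refine ((h1.add h2).neg).mono h.weight_nonneg (le_of_eq ?_)
  ring

/-- Start of the bootstrap: 0-jets of `P`, `R`, `e` give 1-jets of `P` and `R`; these give a 1-jet
of `e` and 2-jets of `P` and `R`. It ends there because `H₁` has a 2-jet only. The constants are the
values of the formulas in `jet_derivP` and `jet_derivInv`, rounded up for `jet_R_two`. -/
theorem jet_P_one (h : GappedFamily a b d H H₁ H₂ H₃ P R E e) :
    JetBound (jetWeight a b d) 4 1 0 P := by
  have h1 := h.jet_derivP (n := 0) (by norm_num) zero_le_one zero_le_one h.jet_P_zero h.jet_R_zero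
    h.jet_H₁.of_succ.of_succ
  exact (h.jet_P_zero.cons h.weight_nonneg h.deriv_P h1).mono h.weight_nonneg (by norm_num)

theorem jet_derivInv (h : GappedFamily a b d H H₁ H₂ H₃ P R E e) {n : ℕ} {p q r x z : ℝ}
    (hn : n ≤ 2) (hx : 0 ≤ x) (hp : 0 ≤ p) (hr : 0 ≤ r)
    (hz : 2 ^ n * (2 ^ n * (x * (1 + r + p)) * x) ≤ z)
    (hR : JetBound (jetWeight a b d) x n 0 R)
    (he : JetBound (jetWeight a b d) r n 1 (fun s => (e s : ℂ) • (1 : QOp N)))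
    (hH : JetBound (jetWeight a b d) 1 n 1 H₁)
    (hP : JetBound (jetWeight a b d) p n 1
      (fun s => -((R s - P s) * H₁ s * P s + P s * H₁ s * (R s - P s)))) 
    (hq : max 1 z ≤ q) :
    JetBound (jetWeight a b d) q (n + 1) 0 R := by
  have h1 := h.jet_mul (h.jet_mul (z := 2 ^ n * (x * (1 + r + p))) hR ((hH.sub he).add hP) hx
    (by positivity) (by lia) le_rfl) hR (by positivity) hx (by lia) hz
  exact (h.jet_R_zero.cons h.weight_nonneg (fun s hs => h.deriv_inv hs) h1.neg).mono
    h.weight_nonneg hq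

theorem jet_R_one (h : GappedFamily a b d H H₁ H₂ H₃ P R E e) :
    JetBound (jetWeight a b d) 6 1 0 R := by
  have h1 := h.jet_derivP (n := 0) (by norm_num) zero_le_one zero_le_one h.jet_P_zero h.jet_R_zero
    h.jet_H₁.of_succ.of_succ
  exact h.jet_derivInv (n := 0) (z := 6) (by norm_num) zero_le_one (by norm_num) zero_le_one
    (by norm_num) h.jet_R_zero h.jet_e_zero h.jet_H₁.of_succ.of_succ h1 (by norm_num)

theorem jet_P_two (h : GappedFamily a b d H H₁ H₂ H₃ P R E e) :
    JetBound (jetWeight a b d) 320 2 0 P := by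
  have h1 := h.jet_derivP (n := 1) (by norm_num) (by norm_num) (by norm_num) h.jet_P_one
    h.jet_R_one h.jet_H₁.of_succ
  exact (h.jet_P_zero.cons h.weight_nonneg h.deriv_P h1).mono h.weight_nonneg (by norm_num)

theorem proj_derivP_proj (h : GappedFamily a b d H H₁ H₂ H₃ P R E e) {s : ℝ}
    (hs : s ∈ Icc (0 : ℝ) 1) :
    P s * -((R s - P s) * H₁ s * P s + P s * H₁ s * (R s - P s)) * P s = 0 := by
  have h1 : P s * (R s - P s) = 0 := by rw [mul_sub, h.proj_inv hs, h.proj_sq hs, sub_self]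
  have h2 : (R s - P s) * P s = 0 := by rw [sub_mul, h.inv_proj hs, h.proj_sq hs, sub_self]
  exact proj_mul_offDiag_mul_proj h1 h2

/-- The eigenvalue has no differentiable formula of its own here; its second derivative is read off
from `e P = P H₁ P`. The constant is that of the right-hand side, `2 * (8 * 4)`. -/
theorem jet_e_one (h : GappedFamily a b d H H₁ H₂ H₃ P R E e) :
    JetBound (jetWeight a b d) 64 1 1 (fun s => (e s : ℂ) • (1 : QOp N)) := by
  have hF : JetBound (jetWeight a b d) 64 1 1 (fun s => P s * H₁ s * P s) :=
    h.jet_mul (h.jet_mul (z := 8) h.jet_P_one h.jet_H₁.of_succ) h.jet_P_one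
  obtain ⟨_, F', hF', hF1⟩ := hF
  have key : ∀ s ∈ Icc (0 : ℝ) 1, ∃ e' : ℝ, HasDerivWithinAt e e' (Icc 0 1) s ∧ |e'| ≤ ‖F' s‖ := by
    intro s hs
    obtain ⟨g, hg, hP⟩ := h.proj s hs
    exact exists_hasDerivWithinAt_of_smul_proj hs hg hP (h.deriv_P s hs)
      (h.proj_derivP_proj hs) (hF' s hs) h.smul_proj
  choose! e' he' hb using key
  refine ⟨fun s hs => (h.jet_e_zero s hs).trans ?_, fun s => (e' s : ℂ) • (1 : QOp N),
    fun s hs => (he' s hs).ofReal_comp.smul_const (1 : QOp N), fun s hs => ?_⟩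
  · exact mul_le_mul_of_nonneg_right (by norm_num) (h.weight_nonneg 1)
  · have h1 : ‖(1 : QOp N)‖ ≤ 1 := ContinuousLinearMap.norm_id_le
    rw [norm_smul, Complex.norm_real, Real.norm_eq_abs]
    calc |e' s| * ‖(1 : QOp N)‖ ≤ |e' s| * 1 := by gcongr
      _ ≤ ‖F' s‖ := by rw [mul_one]; exact hb s hs
      _ ≤ _ := hF1 s hs

theorem jet_R_two (h : GappedFamily a b d H H₁ H₂ H₃ P R E e) :
    JetBound (jetWeight a b d) 100000 2 0 R := by
  have h1 := h.jet_derivP (n := 1) (by norm_num) (by norm_num) (by norm_num) h.jet_P_one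
    h.jet_R_one h.jet_H₁.of_succ
  exact h.jet_derivInv (n := 1) (z := 100000) (by norm_num) (by norm_num) (by norm_num)
    (by norm_num) (by norm_num) h.jet_R_one h.jet_e_one h.jet_H₁.of_succ h1 (by norm_num)

end GappedFamily

/-! ### Commutator equations for the corrections. -/

/-- The second superadiabatic correction solves the commutator equation that has the derivative of
the first correction as its right-hand side. -/
theorem commutator_superadiabatic {A : Type*} [Ring A] {K P S X Z' Y' : A} (hPP : P * P = P)
    (hPS : P * S = 0) (hSP : S * P = 0) (hKP : K * P = 0) (hPK : P * K = 0)
    (hSK : S * K = 1 - P) (hKS : K * S = 1 - P)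
    (hZ : Z' = (S * X * P + P * X * S) * (S * S * X * P) + (1 - P) * Z' * P
      - S * S * X * P * (S * X * P + P * X * S))
    (hY : Y' = -((S * X * P + P * X * S) * (P * X * S * S)) + P * Y' * (1 - P)
      + P * X * S * S * (S * X * P + P * X * S)) :
    K * (S * Z' * P + P * Y' * S + S * S * X * P * (P * X * S * S))
      - (S * Z' * P + P * Y' * S + S * S * X * P * (P * X * S * S)) * K = Z' - Y' := by
  have a1 : ∀ x, P * (P * x) = P * x := fun x => by rw [← mul_assoc, hPP]
  have a2 : ∀ x, P * (S * x) = 0 := fun x => by rw [← mul_assoc, hPS, zero_mul]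
  have a3 : ∀ x, S * (P * x) = 0 := fun x => by rw [← mul_assoc, hSP, zero_mul]
  have a4 : ∀ x, K * (P * x) = 0 := fun x => by rw [← mul_assoc, hKP, zero_mul]
  have a5 : ∀ x, K * (S * x) = x - P * x := fun x => by rw [← mul_assoc, hKS, sub_mul, one_mul]
  -- The blocks of `Z'` and `Y'` inside the range of `P` are both `P X S S S X P` and cancel. The
  -- remaining diagonal block is the commutator of `K` with `S S X P * (P X S S)`, which is why that
  -- product appears in the solution.
  have hZ2 : Z' - Y' = (1 - P) * Z' * P - P * Y' * (1 - P) + S * X * P * (P * X * S * S)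
      - S * S * X * P * (P * X * S) := by
    conv_lhs => rw [hZ, hY]
    simp only [mul_assoc, mul_add, add_mul, mul_sub, sub_mul, a1, a2, a3, mul_zero, mul_one,
      one_mul]
    abel
  rw [hZ2]
  simp only [mul_assoc, mul_add, add_mul, mul_sub, sub_mul, hSP, hPK, hSK, a1, a2, a4, a5,
    mul_zero, mul_one, one_mul]
  abel

/-- Here `K` plays the role of `H - E`. Since `K P = P K = 0`, commuting with `K` multiplies the
lower block by `K` on the left and the upper block by `-K` on the right. Each time one factor `S` is
cancelled, and the signs explain the difference. -/
theorem commutator_firstCorrection {A : Type*} [Ring A] {K P S X : A}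
    (hPS : P * S = 0) (hSP : S * P = 0) (hKP : K * P = 0) (hPK : P * K = 0)
    (hSK : S * K = 1 - P) (hKS : K * S = 1 - P) :
    K * (S * S * X * P - P * X * S * S) - (S * S * X * P - P * X * S * S) * K
      = S * X * P + P * X * S := by
  have a2 : ∀ x, P * (S * x) = 0 := fun x => by rw [← mul_assoc, hPS, zero_mul]
  have a4 : ∀ x, K * (P * x) = 0 := fun x => by rw [← mul_assoc, hKP, zero_mul]
  have a5 : ∀ x, K * (S * x) = x - P * x := fun x => by rw [← mul_assoc, hKS, sub_mul, one_mul]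
  simp only [mul_assoc, mul_sub, sub_mul, hSP, hPK, hSK, a2, a4, a5, mul_zero, mul_one]
  abel

/-! ### Unitarity and almost conserved families. -/

theorem star_evolution_deriv {N : ℕ} (T : ℝ) {H U : QOp N} (hH : IsSelfAdjoint H) :
    star (-(Complex.I * (T : ℂ)) • (H * U)) = (Complex.I * (T : ℂ)) • (star U * H) := by
  rw [star_smul, star_mul, hH.star_eq]
  simp

theorem conj_deriv_eq {A : Type*} [Ring A] [Algebra ℂ A] (c : ℂ) (V H F F' U : A) :
    (c • (V * H) * F + V * F') * U + V * F * (-c • (H * U))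
      = V * (F' + c • (H * F - F * H)) * U := by
  simp only [mul_add, add_mul, mul_sub, sub_mul, smul_mul_assoc, mul_smul_comm, mul_assoc,
    neg_smul, smul_sub, mul_neg]
  abel

namespace IsEvolution

variable {N : ℕ} {T : ℝ} {H U : ℝ → QOp N}

theorem star_mul_self (hU : IsEvolution T H U)
    (hH : ∀ s ∈ Icc (0 : ℝ) 1, IsSelfAdjoint (H s)) {s : ℝ} (hs : s ∈ Icc (0 : ℝ) 1) :
    star (U s) * U s = 1 := by
  have hd : ∀ s ∈ Icc (0 : ℝ) 1,
      HasDerivWithinAt (fun s => star (U s) * U s) 0 (Icc 0 1) s := by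
    intro s hs
    refine ((hU.hasDeriv s hs).star.mul (hU.hasDeriv s hs)).congr_deriv ?_
    have h2 := conj_deriv_eq (Complex.I * (T : ℂ)) (star (U s)) (H s) 1 0 (U s)
    rw [star_evolution_deriv T (hH s hs)]
    simp only [mul_one, mul_zero, add_zero, one_mul, sub_self, smul_zero, zero_mul] at h2
    exact h2
  have h0 : (0 : ℝ) ∈ Icc (0 : ℝ) 1 := ⟨le_rfl, zero_le_one⟩
  have h1 := Convex.norm_image_sub_le_of_norm_hasDerivWithin_le (C := 0) hd
    (fun s _ => by simp) (convex_Icc 0 1) h0 hs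
  rw [zero_mul, norm_le_zero_iff, sub_eq_zero] at h1
  simpa [hU.init] using h1

theorem mul_star_self (hU : IsEvolution T H U)
    (hH : ∀ s ∈ Icc (0 : ℝ) 1, IsSelfAdjoint (H s)) {s : ℝ} (hs : s ∈ Icc (0 : ℝ) 1) :
    U s * star (U s) = 1 := by
  have h := hU.star_mul_self hH hs
  have hu : IsUnit (U s) := by
    have hi : Function.Injective (U s : QState N →ₗ[ℂ] QState N) := by
      refine Function.LeftInverse.injective (g := (star (U s) : QOp N)) fun x => ?_
      exact congrArg (fun A : QOp N => A x) h
    exact ContinuousLinearMap.isUnit_iff_bijective.mpr ⟨hi, LinearMap.injective_iff_surjective.mp hi⟩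
  obtain ⟨u, hu⟩ := hu
  rw [← hu] at h ⊢
  rw [← Units.inv_eq_of_mul_eq_one_left h, Units.mul_inv]

theorem norm_le_one (hU : IsEvolution T H U)
    (hH : ∀ s ∈ Icc (0 : ℝ) 1, IsSelfAdjoint (H s)) {s : ℝ} (hs : s ∈ Icc (0 : ℝ) 1) :
    ‖U s‖ ≤ 1 := by
  have h := CStarRing.norm_star_mul_self (x := U s)
  have h1 : ‖(1 : QOp N)‖ ≤ 1 := ContinuousLinearMap.norm_id_le
  rw [hU.star_mul_self hH hs] at h
  nlinarith [norm_nonneg (U s)]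

/-- A family that almost satisfies the Heisenberg equation is almost transported by the
evolution. -/
theorem norm_conj_sub_le (hU : IsEvolution T H U)
    (hH : ∀ s ∈ Icc (0 : ℝ) 1, IsSelfAdjoint (H s)) {F F' : ℝ → QOp N} {δ : ℝ}
    (hF : ∀ s ∈ Icc (0 : ℝ) 1, HasDerivWithinAt F (F' s) (Icc 0 1) s)
    (hδ : ∀ s ∈ Icc (0 : ℝ) 1,
      ‖F' s + (Complex.I * (T : ℂ)) • (H s * F s - F s * H s)‖ ≤ δ) :
    ‖star (U 1) * F 1 * U 1 - F 0‖ ≤ δ := by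
  have hd : ∀ s ∈ Icc (0 : ℝ) 1, HasDerivWithinAt (fun s => star (U s) * F s * U s)
      (star (U s) * (F' s + (Complex.I * (T : ℂ)) • (H s * F s - F s * H s)) * U s)
      (Icc 0 1) s := by
    intro s hs
    refine (((hU.hasDeriv s hs).star.mul (hF s hs)).mul (hU.hasDeriv s hs)).congr_deriv ?_
    rw [star_evolution_deriv T (hH s hs)]
    exact conj_deriv_eq (Complex.I * (T : ℂ)) (star (U s)) (H s) (F s) (F' s) (U s)
  have h0 : (0 : ℝ) ∈ Icc (0 : ℝ) 1 := ⟨le_rfl, zero_le_one⟩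
  have h1 : (1 : ℝ) ∈ Icc (0 : ℝ) 1 := ⟨zero_le_one, le_rfl⟩
  have hb : ∀ s ∈ Icc (0 : ℝ) 1,
      ‖star (U s) * (F' s + (Complex.I * (T : ℂ)) • (H s * F s - F s * H s)) * U s‖ ≤ δ := by
    intro s hs
    have hn := hU.norm_le_one hH hs
    calc _ ≤ ‖star (U s)‖ * ‖F' s + (Complex.I * (T : ℂ)) • (H s * F s - F s * H s)‖ * ‖U s‖ :=
          norm_mul₃_le
      _ ≤ 1 * δ * 1 := by
          have hst : ‖star (U s)‖ ≤ 1 := (norm_star (U s)).trans_le hn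
          have := (norm_nonneg _).trans (hδ s hs)
          gcongr
          exact hδ s hs
      _ = δ := by ring
  have h2 := Convex.norm_image_sub_le_of_norm_hasDerivWithin_le hd hb (convex_Icc 0 1) h0 h1
  simpa [hU.init] using h2

/-- The leakage out of the range of a projection `P 1` is controlled by any almost conserved
family `F` close to `P`. -/
theorem norm_leakage_le (hU : IsEvolution T H U)
    (hH : ∀ s ∈ Icc (0 : ℝ) 1, IsSelfAdjoint (H s)) {F P : ℝ → QOp N} {δ ρ : ℝ}
    (hδ : ‖star (U 1) * F 1 * U 1 - F 0‖ ≤ δ) (hPP : P 1 * P 1 = P 1) (hP1 : ‖P 1‖ ≤ 1)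
    (hρ0 : ‖F 0 - P 0‖ ≤ ρ) (hρ1 : ‖F 1 - P 1‖ ≤ ρ) :
    ‖(1 - P 1) * (U 1 * P 0)‖ ≤ 2 * (2 * ρ + δ) := by
  have h1 : (1 : ℝ) ∈ Icc (0 : ℝ) 1 := ⟨zero_le_one, le_rfl⟩
  have hn := hU.norm_le_one hH h1
  have hUU := hU.mul_star_self hH h1
  -- As `(1 - P 1) * P 1 = 0`, one may subtract `P 1 * U 1` from `U 1 * P 0`; inserting `F` splits
  -- the difference into three small terms.
  have e : (1 - P 1) * (U 1 * P 0) = (1 - P 1) * ((F 1 - P 1) * U 1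
      - U 1 * (star (U 1) * F 1 * U 1 - F 0) - U 1 * (F 0 - P 0)) := by
    have e1 : U 1 * (star (U 1) * F 1 * U 1) = F 1 * U 1 := by
      rw [← mul_assoc, ← mul_assoc, hUU, one_mul]
    have e2 : (1 - P 1) * (P 1 * U 1) = 0 := by
      rw [← mul_assoc, sub_mul, hPP, one_mul, sub_self, zero_mul]
    have e3 : (F 1 - P 1) * U 1 - U 1 * (star (U 1) * F 1 * U 1 - F 0) - U 1 * (F 0 - P 0)
        = U 1 * P 0 - P 1 * U 1 := by
      rw [mul_sub, mul_sub, sub_mul, e1]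
      abel
    rw [e3, mul_sub (1 - P 1), e2, sub_zero]
  have hone : ‖(1 : QOp N)‖ ≤ 1 := ContinuousLinearMap.norm_id_le
  have b0 : ‖1 - P 1‖ ≤ 2 := (norm_sub_le _ _).trans (by linarith)
  have b1 : ‖(F 1 - P 1) * U 1‖ ≤ ρ := (norm_mul_le _ _).trans
    ((mul_le_of_le_one_right (norm_nonneg _) hn).trans hρ1)
  have b2 : ‖U 1 * (star (U 1) * F 1 * U 1 - F 0)‖ ≤ δ := (norm_mul_le _ _).trans
    ((mul_le_of_le_one_left (norm_nonneg _) hn).trans hδ)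
  have b3 : ‖U 1 * (F 0 - P 0)‖ ≤ ρ := (norm_mul_le _ _).trans
    ((mul_le_of_le_one_left (norm_nonneg _) hn).trans hρ0)
  rw [e]
  refine (norm_mul_le _ _).trans (mul_le_mul b0 ?_ (norm_nonneg _) zero_le_two)
  exact (norm_sub_le _ _).trans (by
    have := norm_sub_le ((F 1 - P 1) * U 1) (U 1 * (star (U 1) * F 1 * U 1 - F 0))
    linarith)

end IsEvolution

/-! ### The second-order superadiabatic projection. -/

/-- The derivative of an off-diagonal block. -/
theorem deriv_block_eq {N : ℕ} {A B Z : ℝ → QOp N} {A' B' Z' : QOp N} {s : ℝ}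
    (hs : s ∈ Icc (0 : ℝ) 1) (hA : HasDerivWithinAt A A' (Icc 0 1) s)
    (hB : HasDerivWithinAt B B' (Icc 0 1) s) (hZ : HasDerivWithinAt Z Z' (Icc 0 1) s)
    (hAZ : ∀ s ∈ Icc (0 : ℝ) 1, A s * Z s = Z s) (hZB : ∀ s ∈ Icc (0 : ℝ) 1, Z s * B s = Z s) :
    Z' = A' * Z s + A s * Z' * B s + Z s * B' := by
  have h1 : HasDerivWithinAt Z ((A' * Z s + A s * Z') * B s + A s * Z s * B') (Icc 0 1) s :=
    ((hA.mul hZ).mul hB).congr (fun t ht => by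
      change Z t = A t * Z t * B t
      rw [hAZ t ht, hZB t ht]) (by
      change Z s = A s * Z s * B s
      rw [hAZ s hs, hZB s hs])
  have h2 := (uniqueDiffOn_Icc_zero_one s hs).eq_deriv _ hZ h1
  calc Z' = _ := h2
    _ = _ := by rw [add_mul, mul_assoc A', hZB s hs, hAZ s hs]

theorem offDiag_deriv_lower {A : Type*} [Ring A] (D Z M : A) :
    - -D * Z + M + Z * -D = D * Z + M - Z * D := by
  noncomm_ring

theorem offDiag_deriv_upper {A : Type*} [Ring A] (D Y M : A) :
    -D * Y + M + Y * - -D = -(D * Y) + M + Y * D := by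
  noncomm_ring

/-- The commutator of `V` cancels `P'` and that of `W` cancels the `1/T` term with `V'`, so only
`W'` survives. The scalar `E` drops out of all commutators. -/
theorem heisenberg_residual {A : Type*} [Ring A] [Algebra ℂ A] {T : ℂ} (hT : T ≠ 0) {E : ℂ}
    {H P P' V V' W W' : A}
    (hP : H * P = P * H) (hV : (H - E • 1) * V - V * (H - E • 1) = -P')
    (hW : (H - E • 1) * W - W * (H - E • 1) = V') :
    (P' + -(Complex.I * T⁻¹) • V' + (T⁻¹ ^ 2) • W') + (Complex.I * T) •
      (H * (P + -(Complex.I * T⁻¹) • V + (T⁻¹ ^ 2) • W)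
        - (P + -(Complex.I * T⁻¹) • V + (T⁻¹ ^ 2) • W) * H) = (T⁻¹ ^ 2) • W' := by
  have hV' : H * V - V * H = -P' := by
    rw [← hV]
    simp only [sub_mul, mul_sub, smul_mul_assoc, mul_smul_comm, one_mul, mul_one]
    abel
  have hW' : H * W - W * H = V' := by
    rw [← hW]
    simp only [sub_mul, mul_sub, smul_mul_assoc, mul_smul_comm, one_mul, mul_one]
    abel
  have e : H * (P + -(Complex.I * T⁻¹) • V + (T⁻¹ ^ 2) • W)
        - (P + -(Complex.I * T⁻¹) • V + (T⁻¹ ^ 2) • W) * H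
      = -(Complex.I * T⁻¹) • (H * V - V * H) + (T⁻¹ ^ 2) • (H * W - W * H) := by
    simp only [mul_add, add_mul, smul_mul_assoc, mul_smul_comm, smul_sub, hP]
    abel
  rw [e, hV', hW', smul_add, smul_smul, smul_smul]
  have c1 : Complex.I * T * -(Complex.I * T⁻¹) = 1 := by
    have : Complex.I * T * -(Complex.I * T⁻¹) = -(Complex.I * Complex.I) * (T * T⁻¹) := by ring
    rw [this, Complex.I_mul_I, mul_inv_cancel₀ hT]; norm_num
  have c2 : Complex.I * T * T⁻¹ ^ 2 = Complex.I * T⁻¹ := by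
    field_simp
  rw [c1, c2, one_smul, neg_smul]
  abel

namespace GappedFamily

variable {N : ℕ} {a b d : ℝ} {H H₁ H₂ H₃ P R : ℝ → QOp N} {E e : ℝ → ℝ}

/-- The second-order superadiabatic projection. -/
theorem exists_superadiabatic (h : GappedFamily a b d H H₁ H₂ H₃ P R E e) {T : ℝ} (hT : 0 < T) :
    ∃ F F' : ℝ → QOp N, (∀ s ∈ Icc (0 : ℝ) 1, HasDerivWithinAt F (F' s) (Icc 0 1) s) ∧
      (∀ s ∈ Icc (0 : ℝ) 1, ‖F s - P s‖ ≤ 10 ^ 30 * (a / T + (a ^ 2 + b) / T ^ 2)) ∧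
      ∀ s ∈ Icc (0 : ℝ) 1, ‖F' s + (Complex.I * (T : ℂ)) • (H s * F s - F s * H s)‖
        ≤ 10 ^ 30 * ((a ^ 3 + a * b + d) / T ^ 2) := by
  obtain ⟨ha, hb, hd⟩ := h.nonneg
  set S : ℝ → QOp N := fun s => R s - P s with hSdef
  have jS : JetBound (jetWeight a b d) 100320 2 0 S :=
    (h.jet_R_two.sub h.jet_P_two).mono h.weight_nonneg (by norm_num)
  -- `Z` and `Y` are the two off-diagonal blocks of the first correction `V = Z - Y`. Their jets
  -- start at order 1 because each contains one `H₁`; `W`, containing `Z'`, `Y'` or `Z Y`, starts at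
  -- order 2.
  set Z : ℝ → QOp N := fun s => S s * S s * H₁ s * P s with hZdef
  set Y : ℝ → QOp N := fun s => P s * H₁ s * S s * S s with hYdef
  have jZ : JetBound (jetWeight a b d) (3 * 10 ^ 14) 2 1 Z :=
    h.jet_mul (h.jet_mul (z := 2 * 10 ^ 11) (h.jet_mul (z := 5 * 10 ^ 10) jS jS) h.jet_H₁)
      h.jet_P_two
  have jY : JetBound (jetWeight a b d) (3 * 10 ^ 14) 2 1 Y :=
    h.jet_mul (h.jet_mul (z := 6 * 10 ^ 8) (h.jet_mul (z := 1280) h.jet_P_two h.jet_H₁) jS) jS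
  obtain ⟨Z', hZ', jZ'⟩ := jZ.2
  obtain ⟨Y', hY', jY'⟩ := jY.2
  set W : ℝ → QOp N := fun s => S s * Z' s * P s + P s * Y' s * S s + Z s * Y s with hWdef
  have jW : JetBound (jetWeight a b d) (10 ^ 30) 1 2 W := by
    have h1 := h.jet_mul (z := 5 * 10 ^ 22) (h.jet_mul (z := 7 * 10 ^ 19) jS.of_succ jZ')
      h.jet_P_two.of_succ
    have h2 := h.jet_mul (z := 5 * 10 ^ 22) (h.jet_mul (z := 2 * 10 ^ 17) h.jet_P_two.of_succ jY')
      jS.of_succ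
    have h3 := h.jet_mul (z := 2 * 10 ^ 29) jZ.of_succ jY.of_succ
    exact ((h1.add h2).add h3).mono h.weight_nonneg (by norm_num)
  obtain ⟨W', hW', jW'⟩ := jW.2
  have hTc : (T : ℂ) ≠ 0 := by exact_mod_cast hT.ne'
  refine ⟨fun s => P s + -(Complex.I * (T : ℂ)⁻¹) • (Z s - Y s) + ((T : ℂ)⁻¹ ^ 2) • W s,
    fun s => -(S s * H₁ s * P s + P s * H₁ s * S s) + -(Complex.I * (T : ℂ)⁻¹) • (Z' s - Y' s)
      + ((T : ℂ)⁻¹ ^ 2) • W' s, fun s hs => ?_, fun s hs => ?_, fun s hs => ?_⟩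
  · have d1 : HasDerivWithinAt (fun s => -(Complex.I * (T : ℂ)⁻¹) • (Z s - Y s))
        (-(Complex.I * (T : ℂ)⁻¹) • (Z' s - Y' s)) (Icc 0 1) s :=
      HasDerivWithinAt.fun_const_smul _ (HasDerivWithinAt.fun_sub (hZ' s hs) (hY' s hs))
    have d2 : HasDerivWithinAt (fun s => ((T : ℂ)⁻¹ ^ 2) • W s)
        (((T : ℂ)⁻¹ ^ 2) • W' s) (Icc 0 1) s :=
      HasDerivWithinAt.fun_const_smul _ (hW' s hs)
    exact HasDerivWithinAt.fun_add (HasDerivWithinAt.fun_add (h.deriv_P s hs) d1) d2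
  · have hZb := jZ.bound s hs
    have hYb := jY.bound s hs
    have hWb := jW.bound s hs
    simp only [jetWeight] at hZb hYb hWb
    have n1 : ‖-(Complex.I * (T : ℂ)⁻¹) • (Z s - Y s)‖ ≤ T⁻¹ * (10 ^ 30 * a) := by
      rw [norm_smul, norm_neg, norm_mul, Complex.norm_I, one_mul, norm_inv, Complex.norm_real,
        Real.norm_of_nonneg hT.le]
      refine mul_le_mul_of_nonneg_left ((norm_sub_le _ _).trans ?_) (by positivity)
      linarith
    have n2 : ‖((T : ℂ)⁻¹ ^ 2) • W s‖ ≤ T⁻¹ ^ 2 * (10 ^ 30 * (a ^ 2 + b)) := by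
      rw [norm_smul, norm_pow, norm_inv, Complex.norm_real, Real.norm_of_nonneg hT.le]
      exact mul_le_mul_of_nonneg_left hWb (by positivity)
    calc _ = ‖-(Complex.I * (T : ℂ)⁻¹) • (Z s - Y s) + ((T : ℂ)⁻¹ ^ 2) • W s‖ := by
          refine congrArg _ ?_
          change P s + _ + _ - P s = _
          rw [add_assoc, add_sub_cancel_left]
      _ ≤ _ := (norm_add_le _ _).trans (add_le_add n1 n2)
      _ = _ := by ring
  · have hPP := h.proj_sq hs
    have hPS : ∀ s ∈ Icc (0 : ℝ) 1, P s * S s = 0 := fun s hs => by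
      rw [hSdef, mul_sub, h.proj_inv hs, h.proj_sq hs, sub_self]
    have hSP : ∀ s ∈ Icc (0 : ℝ) 1, S s * P s = 0 := fun s hs => by
      rw [hSdef, sub_mul, h.inv_proj hs, h.proj_sq hs, sub_self]
    have hKP : (H s - (E s : ℂ) • 1) * P s = 0 := by
      rw [sub_mul, h.mul_proj s hs, smul_mul_assoc, one_mul, sub_self]
    have hPK : P s * (H s - (E s : ℂ) • 1) = 0 := by
      rw [mul_sub, h.proj_mul s hs, mul_smul_comm, mul_one, sub_self]
    have hSK : S s * (H s - (E s : ℂ) • 1) = 1 - P s := by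
      have h1 := h.inv_mul s hs
      rw [mul_add, h.inv_proj hs] at h1
      rw [hSdef, sub_mul, hPK, sub_zero]
      exact eq_sub_of_add_eq h1
    have hKS : (H s - (E s : ℂ) • 1) * S s = 1 - P s := by
      have h1 := h.mul_inv s hs
      rw [add_mul, h.proj_inv hs] at h1
      rw [hSdef, mul_sub, hKP, sub_zero]
      exact eq_sub_of_add_eq h1
    have hPd : HasDerivWithinAt P (-(S s * H₁ s * P s + P s * H₁ s * S s)) (Icc 0 1) s :=
      h.deriv_P s hs
    have hQd : HasDerivWithinAt (fun s => 1 - P s) (-(-(S s * H₁ s * P s + P s * H₁ s * S s)))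
      (Icc 0 1) s := hPd.const_sub 1
    -- Since `Z = (1 - P) Z P` and `Y = P Y (1 - P)`, all blocks of `Z'` and `Y'` other than the
    -- off-diagonal one are determined by `P'`.
    have eZ := deriv_block_eq hs hQd hPd (hZ' s hs)
      (fun s hs => by
        rw [sub_mul, one_mul, hZdef]
        simp only [← mul_assoc]
        rw [hPS s hs]
        simp)
      (fun s hs => by rw [hZdef, mul_assoc, h.proj_sq hs])
    have eY := deriv_block_eq hs hPd hQd (hY' s hs)
      (fun s hs => by
        rw [hYdef]
        simp only [← mul_assoc]
        rw [h.proj_sq hs])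
      (fun s hs => by
        rw [mul_sub, mul_one, hYdef]
        simp only [mul_assoc]
        rw [hSP s hs]
        simp)
    have hV := commutator_firstCorrection (X := H₁ s) (hPS s hs) (hSP s hs) hKP hPK hSK hKS
    have hW := commutator_superadiabatic (X := H₁ s) (Z' := Z' s) (Y' := Y' s) hPP (hPS s hs)
      (hSP s hs) hKP hPK hSK hKS (eZ.trans (offDiag_deriv_lower _ _ _))
      (eY.trans (offDiag_deriv_upper _ _ _))
    have hres := heisenberg_residual (T := (T : ℂ)) hTc (E := (E s : ℂ)) (H := H s) (P := P s)
      (P' := -(S s * H₁ s * P s + P s * H₁ s * S s)) (V := Z s - Y s) (V' := Z' s - Y' s)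
      (W := W s) (W' := W' s) (by rw [h.mul_proj s hs, h.proj_mul s hs])
      (hV.trans (neg_neg _).symm) hW
    have hWb := jW'.bound s hs
    simp only [jetWeight] at hWb
    calc _ = ‖((T : ℂ)⁻¹ ^ 2) • W' s‖ := congrArg _ hres
      _ ≤ T⁻¹ ^ 2 * (10 ^ 30 * (a ^ 3 + a * b + d)) := by
        rw [norm_smul, norm_pow, norm_inv, Complex.norm_real, Real.norm_of_nonneg hT.le]
        exact mul_le_mul_of_nonneg_left hWb (by positivity)
      _ = _ := by ring

end GappedFamily

/-! ### The spectral gap as a lower bound for the operator. -/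

/-- In an orthonormal eigenbasis `A` multiplies each coordinate by a number of modulus at least `c`.
-/
theorem norm_le_apply_of_energy {N : ℕ} {A : QOp N} (hA : IsSelfAdjoint A) {c : ℝ} (hc : 0 ≤ c)
    (h : ∀ μ : ℝ, IsEnergy A μ → c ≤ |μ|) (x : QState N) : c * ‖x‖ ≤ ‖A x‖ := by
  have hS : (A : QState N →ₗ[ℂ] QState N).IsSymmetric :=
    ContinuousLinearMap.isSelfAdjoint_iff_isSymmetric.mp hA
  have hn : Module.finrank ℂ (QState N) = N := finrank_euclideanSpace_fin
  let b := hS.eigenvectorBasis hn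
  have hb : ∀ i, inner ℂ (b i) (A x) = (hS.eigenvalues hn i : ℂ) * inner ℂ (b i) x := by
    intro i
    have h1 : inner ℂ (b i) (A x) = inner ℂ (A (b i)) x := (hS (b i) x).symm
    have h2 : A (b i) = (hS.eigenvalues hn i : ℂ) • b i := hS.apply_eigenvectorBasis hn i
    rw [h1, h2, inner_smul_left, Complex.conj_ofReal]
  have hsq : (c * ‖x‖) ^ 2 ≤ ‖A x‖ ^ 2 := by
    rw [mul_pow, ← b.sum_sq_norm_inner_right x, ← b.sum_sq_norm_inner_right (A x), Finset.mul_sum]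
    refine Finset.sum_le_sum fun i _ => ?_
    rw [hb, norm_mul, mul_pow, Complex.norm_real, Real.norm_eq_abs]
    have : c ≤ |hS.eigenvalues hn i| := h _ (hS.hasEigenvalue_eigenvalues hn i)
    gcongr
  exact le_of_sq_le_sq hsq (norm_nonneg _)

theorem isSelfAdjoint_stateProj {N : ℕ} (g : QState N) : IsSelfAdjoint (stateProj g) := by
  rw [ContinuousLinearMap.isSelfAdjoint_iff_isSymmetric]
  intro x y
  simp [stateProj, inner_smul_left, inner_smul_right, mul_comm]

theorem IsSelfAdjoint.sub_smul_one_add {N : ℕ} {A B : QOp N} (hA : IsSelfAdjoint A)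
    (hB : IsSelfAdjoint B) (E : ℝ) : IsSelfAdjoint (A - (E : ℂ) • (1 : QOp N) + B) :=
  have h1 : IsSelfAdjoint ((E : ℂ) • (1 : QOp N)) :=
    IsSelfAdjoint.smul (Complex.conj_ofReal E) (IsSelfAdjoint.one _)
  IsSelfAdjoint.add (R := QOp N) (IsSelfAdjoint.sub (R := QOp N) hA h1) hB

theorem isEnergy_of_apply_eq {N : ℕ} {A : QOp N} {μ : ℝ} {x : QState N} (hx : x ≠ 0)
    (h : A x = (μ : ℂ) • x) : IsEnergy A μ :=
  Module.End.hasEigenvalue_of_hasEigenvector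
    ⟨Module.End.mem_eigenspace_iff.mpr h, hx⟩

/-- `A - E + γ P` is bounded below by the gap `γ` around the simple eigenvalue `E`. -/
theorem gap_mul_norm_le {N : ℕ} {A : QOp N} (hA : IsSelfAdjoint A) {E γ : ℝ} (hγ : 0 ≤ γ)
    {g : QState N} (hg : ‖g‖ = 1) (hAg : A g = (E : ℂ) • g)
    (hfin : Module.finrank ℂ (Module.End.eigenspace (A : QState N →ₗ[ℂ] QState N) (E : ℂ)) = 1)
    (hgap : ∀ μ : ℝ, IsEnergy A μ → μ ≠ E → γ ≤ |μ - E|) (x : QState N) :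
    γ * ‖x‖ ≤ ‖(A - (E : ℂ) • 1 + (γ : ℂ) • stateProj g) x‖ := by
  have hM : IsSelfAdjoint (A - (E : ℂ) • (1 : QOp N) + (γ : ℂ) • stateProj g) :=
    hA.sub_smul_one_add (IsSelfAdjoint.smul (Complex.conj_ofReal γ) (isSelfAdjoint_stateProj g)) E
  refine norm_le_apply_of_energy hM hγ (fun ν hν => ?_) x
  obtain ⟨y, hy⟩ := hν.exists_hasEigenvector
  have hy0 : y ≠ 0 := hy.2
  have hye : A y - (E : ℂ) • y + (γ : ℂ) • (inner ℂ g y • g) = (ν : ℂ) • y := hy.apply_eq_smul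
  have hsym := ContinuousLinearMap.isSelfAdjoint_iff_isSymmetric.mp hA
  have hgy : inner ℂ g (A y) = (E : ℂ) * inner ℂ g y := by
    have h1 : inner ℂ g (A y) = inner ℂ (A g) y := (hsym g y).symm
    rw [h1, hAg, inner_smul_left, Complex.conj_ofReal]
  have h3 : (γ : ℂ) * inner ℂ g y = (ν : ℂ) * inner ℂ g y := by
    have h4 := congrArg (inner ℂ g) hye
    rw [inner_add_right, inner_sub_right, inner_smul_right, inner_smul_right, inner_smul_right,
      inner_smul_right, hgy, inner_self_eq_norm_sq_to_K, hg] at h4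
    simpa using h4
  -- Either `y` is orthogonal to `g`, and then `ν + E` is an eigenvalue of `A`, different from `E`
  -- by simplicity; or `h3` forces `ν = γ`.
  by_cases h0 : inner ℂ g y = 0
  · rw [h0, zero_smul, smul_zero, add_zero] at hye
    have hAy : A y = ((ν + E : ℝ) : ℂ) • y := by
      push_cast
      rw [add_smul, ← hye, sub_add_cancel]
    by_cases hν0 : ν = 0
    · exfalso
      have hgmem : g ∈ Module.End.eigenspace (A : QState N →ₗ[ℂ] QState N) (E : ℂ) :=
        Module.End.mem_eigenspace_iff.mpr hAg
      have hymem : y ∈ Module.End.eigenspace (A : QState N →ₗ[ℂ] QState N) (E : ℂ) := by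
        refine Module.End.mem_eigenspace_iff.mpr ?_
        simpa [hν0] using hAy
      have hg0 : (⟨g, hgmem⟩ : Module.End.eigenspace (A : QState N →ₗ[ℂ] QState N) (E : ℂ)) ≠ 0 := by
        intro hz
        have : g = 0 := congrArg Subtype.val hz
        rw [this, norm_zero] at hg
        exact zero_ne_one hg
      obtain ⟨c, hc⟩ := (finrank_eq_one_iff_of_nonzero' _ hg0).mp hfin ⟨y, hymem⟩
      have hcy : c • g = y := congrArg Subtype.val hc
      rw [← hcy, inner_smul_right, inner_self_eq_norm_sq_to_K, hg] at h0
      have hc0 : c = 0 := by simpa using h0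
      rw [hc0, zero_smul] at hcy
      exact hy0 hcy.symm
    · have := hgap (ν + E) (isEnergy_of_apply_eq hy0 hAy) (by simpa using hν0)
      simpa using this
  · have : γ = ν := by exact_mod_cast mul_right_cancel₀ h0 h3
    rw [this]
    exact le_abs_self ν

theorem exists_inverse_of_norm_le {N : ℕ} {M : QOp N} (h : ∀ x, ‖x‖ ≤ ‖M x‖) :
    ∃ R : QOp N, R * M = 1 ∧ M * R = 1 ∧ ‖R‖ ≤ 1 := by
  have hi : Function.Injective (M : QState N →ₗ[ℂ] QState N) := by
    refine (injective_iff_map_eq_zero _).mpr fun x hx => ?_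
    have h1 := h x
    have h2 : M x = 0 := hx
    rwa [h2, norm_zero, norm_le_zero_iff] at h1
  obtain ⟨u, rfl⟩ := ContinuousLinearMap.isUnit_iff_bijective.mpr
    (⟨hi, LinearMap.injective_iff_surjective.mp hi⟩ : Function.Bijective M)
  refine ⟨((u⁻¹ : (QOp N)ˣ) : QOp N), u.inv_mul, u.mul_inv, ?_⟩
  refine ContinuousLinearMap.opNorm_le_bound _ zero_le_one fun y => ?_
  have h1 := h ((u⁻¹ : (QOp N)ˣ).val y)
  have h2 : u.val ((u⁻¹ : (QOp N)ˣ).val y) = y :=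
    congrArg (fun A : QOp N => A y) u.mul_inv
  rw [h2] at h1
  rwa [one_mul]

/-! ### Perturbation theory of a simple eigenvalue. -/

/-- Because `B t = 0`, the difference quotient is the slope of `B` applied to `x s`, so continuity
of `x` suffices. This allows eigenvectors not yet known to be differentiable. -/
theorem hasDerivWithinAt_apply_of_eq_zero {N : ℕ} {B : ℝ → QOp N} {B' : QOp N}
    {x : ℝ → QState N} {t : ℝ} {I : Set ℝ} (hB : HasDerivWithinAt B B' I t) (hB0 : B t = 0)
    (hx : ContinuousWithinAt x I t) :
    HasDerivWithinAt (fun s => B s (x s)) (B' (x t)) I t := by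
  rw [hasDerivWithinAt_iff_tendsto_slope] at hB ⊢
  have hx' : Tendsto x (nhdsWithin t (I \ {t})) (nhds (x t)) :=
    hx.mono_left (nhdsWithin_mono _ sdiff_subset)
  have hc : Continuous fun p : QOp N × QState N => p.1 p.2 := by fun_prop
  have h := (hc.tendsto (B', x t)).comp (hB.prodMk_nhds hx')
  refine h.congr fun s => ?_
  change (slope B t s) (x s) = slope (fun s => B s (x s)) t s
  rw [slope_def_module, slope_def_module, hB0, zero_apply, sub_zero, sub_zero]
  rfl

theorem isBoundedBilinearMap_rankOne (N : ℕ) :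
    IsBoundedBilinearMap ℝ
      (fun p : QState N × QState N => (InnerProductSpace.rankOne ℂ p.1 p.2 : QOp N)) where
  add_left x y z := by simp
  smul_left c x y := by
    ext z : 1
    simp [smul_comm c]
  add_right x y z := by simp
  smul_right c x y := by
    ext z : 1
    have : c • y = (c : ℂ) • y := (Complex.coe_smul c y).symm
    simp only [InnerProductSpace.rankOne_apply, smul_apply]
    rw [this, inner_smul_left, Complex.conj_ofReal, mul_smul, Complex.coe_smul]
  bound := ⟨1, one_pos, fun x y => by simp⟩

theorem HasDerivWithinAt.rankOne {N : ℕ} {x y : ℝ → QState N} {x' y' : QState N} {t : ℝ}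
    {I : Set ℝ} (hx : HasDerivWithinAt x x' I t) (hy : HasDerivWithinAt y y' I t) :
    HasDerivWithinAt (fun s => (InnerProductSpace.rankOne ℂ (x s) (y s) : QOp N))
      (InnerProductSpace.rankOne ℂ (x t) y' + InnerProductSpace.rankOne ℂ x' (y t)) I t := by
  have h := ((isBoundedBilinearMap_rankOne N).hasFDerivAt (x t, y t)).comp_hasDerivWithinAt_of_eq t
    (hx.prodMk hy) rfl
  exact h

theorem stateProj_smul {N : ℕ} (c : ℂ) (v : QState N) :
    stateProj (c • v) = ‖c‖ ^ 2 • (InnerProductSpace.rankOne ℂ v v : QOp N) := by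
  ext z : 1
  rw [← Complex.coe_smul]
  change inner ℂ (c • v) z • c • v = ((‖c‖ ^ 2 : ℝ) : ℂ) • (inner ℂ v z • v)
  rw [inner_smul_left, smul_smul, smul_smul]
  congr 1
  have : ((‖c‖ ^ 2 : ℝ) : ℂ) = (starRingEnd ℂ) c * c := by
    rw [Complex.conj_mul']; push_cast; rfl
  rw [this]
  ring

/-- First-order perturbation theory of a simple eigenvalue and of its eigenprojection. -/
theorem hasDerivWithinAt_energy_stateProj {N : ℕ} {H : ℝ → QOp N} {D S : QOp N} {E : ℝ → ℝ}
    {G : ℝ → QState N} {I : Set ℝ} {t : ℝ} (ht : t ∈ I) (hH : HasDerivWithinAt H D I t)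
    (hsa : IsSelfAdjoint (H t)) (hD : IsSelfAdjoint D) (hE : ContinuousWithinAt E I t)
    (hG : ∀ s ∈ I, ‖G s‖ = 1) (hHG : ∀ s ∈ I, H s (G s) = (E s : ℂ) • G s)
    (hS : S * (H t - (E t : ℂ) • 1) = 1 - stateProj (G t)) (hSG : S (G t) = 0)
    (hSsa : IsSelfAdjoint S) :
    HasDerivWithinAt E (inner ℂ (G t) (D (G t))).re I t ∧
      HasDerivWithinAt (fun s => stateProj (G s))
        (-(S * D * stateProj (G t) + stateProj (G t) * D * S)) I t := by
  set g := G t with hg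
  have hg1 : ‖g‖ = 1 := hG t ht
  have hgg : inner ℂ g g = (1 : ℂ) := by rw [inner_self_eq_norm_sq_to_K, hg1]; simp
  set α : ℝ → ℂ := fun s => inner ℂ g (G s) with hα
  -- `B s` is `H t - E t` minus `H s - E s`, and the latter kills `G s`. Applying `S` to `(H t - E
  -- t) (G s) = B s (G s)` gives `key`.
  set B : ℝ → QOp N := fun s => (H t - H s) + ((E s - E t : ℝ) : ℂ) • 1 with hB
  have hBt : B t = 0 := by
    change (H t - H t) + ((E t - E t : ℝ) : ℂ) • (1 : QOp N) = 0
    rw [sub_self, sub_self, Complex.ofReal_zero]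
    exact (zero_add _).trans (zero_smul ℂ (1 : QOp N))
  have hBc : ContinuousWithinAt B I t := by
    have h1 : ContinuousWithinAt (fun s => ((E s - E t : ℝ) : ℂ)) I t :=
      Complex.continuous_ofReal.continuousAt.comp_continuousWithinAt
        (hE.sub continuousWithinAt_const)
    exact (continuousWithinAt_const.sub hH.continuousWithinAt).add
      (h1.smul continuousWithinAt_const)
  have key : ∀ s ∈ I, G s - α s • g = S (B s (G s)) := by
    intro s hs
    have h1 : (H t - (E t : ℂ) • (1 : QOp N)) (G s) = B s (G s) := by
      change H t (G s) - (E t : ℂ) • G s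
        = (H t (G s) - H s (G s)) + ((E s - E t : ℝ) : ℂ) • G s
      rw [hHG s hs]
      push_cast
      rw [sub_smul]
      abel
    rw [← h1]
    have h2 := congrArg (fun A : QOp N => A (G s)) hS
    change S ((H t - (E t : ℂ) • (1 : QOp N)) (G s)) = G s - inner ℂ g (G s) • g at h2
    exact h2.symm
  have hlim : Tendsto (fun s => ‖S‖ * ‖B s‖) (nhdsWithin t I) (nhds 0) := by
    have h1 : Tendsto (fun s => ‖S‖ * ‖B s‖) (nhdsWithin t I) (nhds (‖S‖ * ‖B t‖)) :=
      Tendsto.const_mul ‖S‖ (Tendsto.norm hBc)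
    simpa [hBt] using h1
  have hα2 : ∀ᶠ s in nhdsWithin t I, s ∈ I ∧ 1 / 2 ≤ ‖α s‖ := by
    filter_upwards [hlim.eventually_le_const (by norm_num : (0 : ℝ) < 1 / 2),
      self_mem_nhdsWithin] with s hs hsI
    refine ⟨hsI, ?_⟩
    have h1 : ‖G s - α s • g‖ ≤ 1 / 2 := by
      rw [key s hsI]
      calc ‖S (B s (G s))‖ ≤ ‖S‖ * ‖B s (G s)‖ := S.le_opNorm _
        _ ≤ ‖S‖ * (‖B s‖ * ‖G s‖) := by gcongr; exact (B s).le_opNorm _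
        _ ≤ 1 / 2 := by rw [hG s hsI, mul_one]; exact hs
    have h2 := norm_sub_norm_le (G s) (α s • g)
    rw [norm_smul, hg1, hG s hsI, mul_one] at h2
    linarith
  -- Dividing by the overlap with `g` removes the arbitrary phase of `G`. The fixed-point equation
  -- `x = g + S (B x)` then gives continuity of `x`, next differentiability of `E`, hence of `B`,
  -- and finally of `x`.
  set x : ℝ → QState N := fun s => (α s)⁻¹ • G s with hx
  have hαt : α t = 1 := hgg
  have hxt : x t = g := by simp [hx, hαt, hg]
  have hxe : ∀ᶠ s in nhdsWithin t I, x s = g + S (B s (x s)) := by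
    filter_upwards [hα2] with s hs
    have h0 : α s ≠ 0 := norm_pos_iff.mp (by linarith [hs.2])
    have h1 := congrArg (fun v => (α s)⁻¹ • v) (key s hs.1)
    simp only [smul_sub, smul_smul, inv_mul_cancel₀ h0, one_smul] at h1
    simp only [hx, map_smul]
    rw [← h1]
    abel
  have hxc : ContinuousWithinAt x I t := by
    have h1 : Tendsto (fun s => x s - g) (nhdsWithin t I) (nhds 0) := by
      refine squeeze_zero_norm' (a := fun s => 2 * (‖S‖ * ‖B s‖)) ?_ (by simpa using hlim.const_mul 2)
      filter_upwards [hxe, hα2] with s hs hs2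
      have h2 : x s - g = S (B s (x s)) := sub_eq_of_eq_add' hs
      have h3 : ‖x s‖ ≤ 2 := by
        simp only [hx, norm_smul, norm_inv, hG s hs2.1, mul_one]
        rw [inv_le_comm₀ (by linarith [hs2.2]) two_pos]
        linarith [hs2.2]
      rw [h2]
      calc ‖S (B s (x s))‖ ≤ ‖S‖ * ‖B s (x s)‖ := S.le_opNorm _
        _ ≤ ‖S‖ * (‖B s‖ * 2) := by
          gcongr
          exact ((B s).le_opNorm _).trans (by gcongr)
        _ = _ := by ring
    have h2 := h1.add_const g
    simp only [sub_add_cancel, zero_add] at h2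
    rw [ContinuousWithinAt, hxt]
    exact h2
  have hEd : HasDerivWithinAt E (inner ℂ g (D g)).re I t := by
    have h1 : HasDerivWithinAt (fun s => (H s - H t) (x s)) (D (x t)) I t :=
      hasDerivWithinAt_apply_of_eq_zero (hH.sub_const (H t)) (sub_self _) hxc
    have h2 : HasDerivWithinAt (fun s => (inner ℂ g ((H s - H t) (x s))).re)
        (inner ℂ g (D (x t))).re I t :=
      (Complex.reCLM.comp ((innerSL ℂ g).restrictScalars ℝ)).hasFDerivAt.comp_hasDerivWithinAt t h1
    rw [hxt] at h2
    have h3 : ∀ s ∈ I, 1 / 2 ≤ ‖α s‖ →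
        E s = (inner ℂ g ((H s - H t) (x s))).re + E t := by
      intro s hs hs2
      have h0 : α s ≠ 0 := norm_pos_iff.mp (by linarith)
      have h4 : inner ℂ g (x s) = (1 : ℂ) := by
        rw [hx, inner_smul_right]
        exact inv_mul_cancel₀ h0
      have h5 : H s (x s) = (E s : ℂ) • x s := by
        rw [hx, map_smul, hHG s hs, smul_comm]
      have h6 : inner ℂ g (H t (x s)) = (E t : ℂ) := by
        have h7 : inner ℂ g (H t (x s)) = inner ℂ (H t g) (x s) :=
          (ContinuousLinearMap.isSelfAdjoint_iff_isSymmetric.mp hsa g (x s)).symm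
        rw [h7, hg, hHG t ht, ← hg, inner_smul_left, h4, Complex.conj_ofReal, mul_one]
      rw [sub_apply, inner_sub_right, h5, inner_smul_right, h4, h6]
      simp
    refine (h2.add_const (E t)).congr_of_eventuallyEq ?_ (h3 t ht (by rw [hαt]; norm_num))
    filter_upwards [hα2] with s hs using h3 s hs.1 hs.2
  refine ⟨hEd, ?_⟩
  have hBd : HasDerivWithinAt B (-D + (((inner ℂ g (D g)).re : ℝ) : ℂ) • (1 : QOp N)) I t := by
    have h1 : HasDerivWithinAt (fun s => ((E s - E t : ℝ) : ℂ) • (1 : QOp N))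
        ((((inner ℂ g (D g)).re : ℝ) : ℂ) • (1 : QOp N)) I t :=
      (hEd.sub_const (E t)).ofReal_comp.smul_const (1 : QOp N)
    exact HasDerivWithinAt.fun_add (hH.const_sub (H t)) h1
  have hxd : HasDerivWithinAt x (-(S (D g))) I t := by
    have h1 := hasDerivWithinAt_apply_of_eq_zero hBd hBt hxc
    have h2 : HasDerivWithinAt (fun s => S (B s (x s)))
        (S ((-D + (((inner ℂ g (D g)).re : ℝ) : ℂ) • (1 : QOp N)) (x t))) I t :=
      (S.restrictScalars ℝ).hasFDerivAt.comp_hasDerivWithinAt t h1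
    have h3 : S ((-D + (((inner ℂ g (D g)).re : ℝ) : ℂ) • (1 : QOp N)) (x t)) = -(S (D g)) := by
      rw [hxt]
      change S (-(D g) + (((inner ℂ g (D g)).re : ℝ) : ℂ) • g) = _
      rw [map_add, map_neg, map_smul, hSG, smul_zero, add_zero]
    rw [h3] at h2
    exact (h2.const_add g).congr_of_eventuallyEq hxe (by simp [hxt, hBt])
  have hSsym := ContinuousLinearMap.isSelfAdjoint_iff_isSymmetric.mp hSsa
  have hDsym := ContinuousLinearMap.isSelfAdjoint_iff_isSymmetric.mp hD
  -- The velocity `-S (D g)` of `x` is orthogonal to `g`, so normalization does not contribute to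
  -- first order.
  have hn : HasDerivWithinAt (fun s => (‖x s‖ ^ 2)⁻¹) 0 I t := by
    have h4 : inner ℂ g (S (D g)) = 0 := by
      have h5 : inner ℂ g (S (D g)) = inner ℂ (S g) (D g) := (hSsym g (D g)).symm
      rw [h5, hSG, inner_zero_left]
    have h1 := Complex.reCLM.hasFDerivAt.comp_hasDerivWithinAt t (hxd.inner ℂ hxd)
    have h2 : inner ℂ (x t) (-(S (D g))) + inner ℂ (-(S (D g))) (x t) = 0 := by
      rw [hxt, inner_neg_right, inner_neg_left, h4, inner_eq_zero_symm.mp h4]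
      simp
    rw [h2, map_zero] at h1
    have h6 : ∀ s, (Complex.reCLM ∘ fun s => inner ℂ (x s) (x s)) s = ‖x s‖ ^ 2 := fun s =>
      inner_self_eq_norm_sq (𝕜 := ℂ) (x s)
    have h3 := (h1.congr (fun s _ => (h6 s).symm) (h6 t).symm).fun_inv
      (by rw [hxt, hg1]; norm_num)
    simpa using h3
  have hr := HasDerivWithinAt.fun_smul hn (hxd.rankOne hxd)
  have hev : ∀ s ∈ I, 1 / 2 ≤ ‖α s‖ → stateProj (G s)
      = (‖x s‖ ^ 2)⁻¹ • (InnerProductSpace.rankOne ℂ (x s) (x s) : QOp N) := by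
    intro s hs hs2
    have h0 : α s ≠ 0 := norm_pos_iff.mp (by linarith)
    have hGx : G s = α s • x s := by rw [hx, smul_smul, mul_inv_cancel₀ h0, one_smul]
    have hxn : ((‖x s‖ ^ 2)⁻¹ : ℝ) = ‖α s‖ ^ 2 := by
      rw [hx, norm_smul, hG s hs, norm_inv, mul_one, inv_pow, inv_inv]
    rw [hxn, hGx]
    exact stateProj_smul _ _
  refine (hr.congr_of_eventuallyEq (f₁ := fun s => stateProj (G s)) ?_
    (hev t ht (by rw [hαt]; norm_num))).congr_deriv ?_
  · filter_upwards [hα2] with s hs using hev s hs.1 hs.2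
  · rw [hxt, hg1]
    ext z : 1
    have h1 : inner ℂ (S (D g)) z = inner ℂ g (D (S z)) := by
      have e1 : inner ℂ (S (D g)) z = inner ℂ (D g) (S z) := hSsym (D g) z
      have e2 : inner ℂ (D g) (S z) = inner ℂ g (D (S z)) := hDsym g (S z)
      rw [e1, e2]
    rw [zero_smul, add_zero, one_pow, inv_one, one_smul]
    change inner ℂ (-(S (D g))) z • g + inner ℂ g z • (-(S (D g)))
      = -(S (D (inner ℂ g z • g)) + inner ℂ g (D (S z)) • g)
    rw [inner_neg_left, h1, map_smul, map_smul, neg_smul, smul_neg, neg_add, add_comm]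

/-! ### Landau's inequality and construction of the gapped family. -/

theorem isSelfAdjoint_of_hasDerivWithinAt {N : ℕ} {H : ℝ → QOp N} {D : QOp N} {s : ℝ}
    (hs : s ∈ Icc (0 : ℝ) 1) (hH : HasDerivWithinAt H D (Icc 0 1) s)
    (hsa : ∀ s ∈ Icc (0 : ℝ) 1, IsSelfAdjoint (H s)) : IsSelfAdjoint D := by
  have h1 : HasDerivWithinAt H (star D) (Icc 0 1) s :=
    hH.star.congr (fun t ht => (hsa t ht).star_eq.symm) (hsa s hs).star_eq.symm
  exact (uniqueDiffOn_Icc_zero_one s hs).eq_deriv _ h1 hH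

/-- Landau's inequality on the unit interval. -/
theorem norm_deriv_le_of_norm_second_deriv_le {V : Type*} [NormedAddCommGroup V]
    [NormedSpace ℝ V] {f f' f'' : ℝ → V} {a d : ℝ}
    (hf : ∀ s ∈ Icc (0 : ℝ) 1, HasDerivWithinAt f (f' s) (Icc 0 1) s)
    (hf' : ∀ s ∈ Icc (0 : ℝ) 1, HasDerivWithinAt f' (f'' s) (Icc 0 1) s)
    (ha : ∀ s ∈ Icc (0 : ℝ) 1, ‖f s‖ ≤ a) (hd : ∀ s ∈ Icc (0 : ℝ) 1, ‖f'' s‖ ≤ d) :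
    ∀ s ∈ Icc (0 : ℝ) 1, ‖f' s‖ ≤ 4 * a + d := by
  intro s hs
  have hd0 : 0 ≤ d := (norm_nonneg _).trans (hd s hs)
  -- From every point of `[0,1]` a step of length 1/2 in one direction stays inside. Taylor's
  -- formula on it gives `‖f' s‖ / 2 ≤ 2 a + d / 2`.
  obtain ⟨r, hr, hrs⟩ : ∃ r ∈ Icc (0 : ℝ) 1, |r - s| = 1 / 2 := by
    rcases le_total s (1 / 2) with h | h
    · refine ⟨s + 1 / 2, ⟨by linarith [hs.1], by linarith⟩, ?_⟩
      rw [add_sub_cancel_left, abs_of_pos (by norm_num)]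
    · refine ⟨s - 1 / 2, ⟨by linarith, by linarith [hs.2]⟩, ?_⟩
      rw [sub_sub_cancel_left, abs_neg, abs_of_pos (by norm_num)]
  have hφ : ∀ t ∈ Icc (0 : ℝ) 1,
      HasDerivWithinAt (fun t => f t - t • f' s) (f' t - (1 : ℝ) • f' s) (Icc 0 1) t :=
    fun t ht => HasDerivWithinAt.fun_sub (hf t ht) ((hasDerivWithinAt_id t _).smul_const (f' s))
  have hb : ∀ t ∈ Icc (0 : ℝ) 1, ‖f' t - (1 : ℝ) • f' s‖ ≤ d := by
    intro t ht
    rw [one_smul]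
    refine (Convex.norm_image_sub_le_of_norm_hasDerivWithin_le hf' hd (convex_Icc 0 1) hs ht).trans
      (mul_le_of_le_one_right hd0 ?_)
    rw [Real.norm_eq_abs, abs_le]
    constructor <;> linarith [hs.1, hs.2, ht.1, ht.2]
  have h1 := Convex.norm_image_sub_le_of_norm_hasDerivWithin_le hφ hb (convex_Icc 0 1) hs hr
  rw [Real.norm_eq_abs, hrs] at h1
  have h2 : (r - s) • f' s = f r - f s - ((f r - r • f' s) - (f s - s • f' s)) := by
    rw [sub_smul]; abel
  have h3 : 1 / 2 * ‖f' s‖ ≤ (a + a) + d * (1 / 2) := by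
    rw [← hrs, ← Real.norm_eq_abs, ← norm_smul, h2, Real.norm_eq_abs, hrs]
    exact (norm_sub_le _ _).trans (add_le_add ((norm_sub_le _ _).trans
      (add_le_add (ha r hr) (ha s hs))) h1)
  linarith

/-- A family of self-adjoint operators with a unit gap around a simple eigenvalue. -/
theorem exists_gappedFamily {N : ℕ} {a b d : ℝ} {H H₁ H₂ H₃ : ℝ → QOp N} {E : ℝ → ℝ}
    {G : ℝ → QState N}
    (h₀ : ∀ s ∈ Icc (0 : ℝ) 1, HasDerivWithinAt H (H₁ s) (Icc 0 1) s)
    (h₁ : ∀ s ∈ Icc (0 : ℝ) 1, HasDerivWithinAt H₁ (H₂ s) (Icc 0 1) s)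
    (h₂ : ∀ s ∈ Icc (0 : ℝ) 1, HasDerivWithinAt H₂ (H₃ s) (Icc 0 1) s)
    (ha : ∀ s ∈ Icc (0 : ℝ) 1, ‖H₁ s‖ ≤ a) (hb : ∀ s ∈ Icc (0 : ℝ) 1, ‖H₂ s‖ ≤ b)
    (hd : ∀ s ∈ Icc (0 : ℝ) 1, ‖H₃ s‖ ≤ d)
    (hsa : ∀ s ∈ Icc (0 : ℝ) 1, IsSelfAdjoint (H s)) (hE : ContinuousOn E (Icc 0 1))
    (hG : ∀ s ∈ Icc (0 : ℝ) 1, ‖G s‖ = 1)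
    (hHG : ∀ s ∈ Icc (0 : ℝ) 1, H s (G s) = (E s : ℂ) • G s)
    (hgap : ∀ s ∈ Icc (0 : ℝ) 1, ∀ x,
      ‖x‖ ≤ ‖(H s - (E s : ℂ) • 1 + stateProj (G s)) x‖) :
    ∃ (R : ℝ → QOp N) (e : ℝ → ℝ),
      GappedFamily a b d H H₁ H₂ H₃ (fun s => stateProj (G s)) R E e := by
  choose! R hRM hMR hR using fun s hs => exists_inverse_of_norm_le (hgap s hs)
  have hHP : ∀ s ∈ Icc (0 : ℝ) 1, H s * stateProj (G s) = (E s : ℂ) • stateProj (G s) := by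
    intro s hs
    ext z : 1
    change H s (inner ℂ (G s) z • G s) = (E s : ℂ) • (inner ℂ (G s) z • G s)
    rw [map_smul, hHG s hs, smul_comm]
  have hPH : ∀ s ∈ Icc (0 : ℝ) 1, stateProj (G s) * H s = (E s : ℂ) • stateProj (G s) := by
    intro s hs
    have h := congrArg star (hHP s hs)
    rw [star_mul, star_smul, (hsa s hs).star_eq, (isSelfAdjoint_stateProj (G s)).star_eq] at h
    rw [h]
    congr 1
    exact Complex.conj_ofReal _
  have hPP : ∀ s ∈ Icc (0 : ℝ) 1, stateProj (G s) * stateProj (G s) = stateProj (G s) :=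
    fun s hs => stateProj_mul_self (hG s hs)
  have hMP : ∀ s ∈ Icc (0 : ℝ) 1,
      (H s - (E s : ℂ) • 1 + stateProj (G s)) * stateProj (G s) = stateProj (G s) := by
    intro s hs
    rw [add_mul, sub_mul, hHP s hs, hPP s hs, smul_mul_assoc, one_mul, sub_self, zero_add]
  have hRP : ∀ s ∈ Icc (0 : ℝ) 1, R s * stateProj (G s) = stateProj (G s) := by
    intro s hs
    calc R s * stateProj (G s)
        = R s * ((H s - (E s : ℂ) • 1 + stateProj (G s)) * stateProj (G s)) := by rw [hMP s hs]
      _ = stateProj (G s) := by rw [← mul_assoc, hRM s hs, one_mul]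
  have hRsa : ∀ s ∈ Icc (0 : ℝ) 1, IsSelfAdjoint (R s) := by
    intro s hs
    have hM : star (H s - (E s : ℂ) • 1 + stateProj (G s))
        = H s - (E s : ℂ) • 1 + stateProj (G s) :=
      (hsa s hs).sub_smul_one_add (isSelfAdjoint_stateProj (G s)) (E s)
    have h := congrArg star (hMR s hs)
    rw [star_mul, hM, star_one] at h
    exact left_inv_eq_right_inv h (hMR s hs)
  have hder : ∀ s (hs : s ∈ Icc (0 : ℝ) 1), _ := fun s hs =>
    hasDerivWithinAt_energy_stateProj (S := R s - stateProj (G s)) hs (h₀ s hs) (hsa s hs)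
      (isSelfAdjoint_of_hasDerivWithinAt hs (h₀ s hs) hsa) (hE s hs) hG hHG
      (by
        have h := hRM s hs
        rw [mul_add, hRP s hs] at h
        rw [sub_mul, mul_sub (stateProj (G s)), hPH s hs, mul_smul_comm, mul_one, sub_self,
          sub_zero]
        exact eq_sub_of_add_eq h)
      (by
        have h := congrArg (fun A : QOp N => A (G s)) (hRP s hs)
        change R s (stateProj (G s) (G s)) = stateProj (G s) (G s) at h
        rw [stateProj_apply_self (hG s hs)] at h
        rw [sub_apply, h, stateProj_apply_self (hG s hs), sub_self])
      (IsSelfAdjoint.sub (R := QOp N) (hRsa s hs) (isSelfAdjoint_stateProj (G s)))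
  refine ⟨R, fun s => (inner ℂ (G s) (H₁ s (G s))).re, h₀, h₁, h₂, ha, hb, hd,
    fun s hs => ⟨G s, hG s hs, rfl⟩, hHP, hPH, hRM, hMR, hR, fun s hs => (hder s hs).1,
    fun s hs => (re_inner_apply_le _ (hG s hs)).trans (ha s hs), fun s hs => ?_,
    fun s hs => (hder s hs).2⟩
  have hsym := ContinuousLinearMap.isSelfAdjoint_iff_isSymmetric.mp
    (isSelfAdjoint_of_hasDerivWithinAt hs (h₀ s hs) hsa)
  have hre : (((inner ℂ (G s) (H₁ s (G s))).re : ℝ) : ℂ) = inner ℂ (G s) (H₁ s (G s)) := by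
    refine Complex.conj_eq_iff_re.mp ?_
    rw [inner_conj_symm]
    exact hsym (G s) (G s)
  rw [hre]
  ext z : 1
  change inner ℂ (G s) (H₁ s (G s)) • (inner ℂ (G s) z • G s)
    = inner ℂ (G s) (H₁ s (inner ℂ (G s) z • G s)) • G s
  rw [map_smul, inner_smul_right, smul_smul, mul_comm]

/-! ### The unit-gap estimate. -/

/-- Mixed terms are interpolated: a power of `a` lies below `a` when `a ≤ 1` and below `a ^ 6`
otherwise, and similarly for `b`. The leftover linear `b` is absorbed through `4 * a + d`, and `a ^
2` through `a ≤ T`. -/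
theorem jetWeight_absorb {a b d T : ℝ} (ha : 0 ≤ a) (hb : 0 ≤ b) (hd : 0 ≤ d) (hT : 1 ≤ T)
    (haT : a ≤ T) (hbd : b ≤ 4 * a + d) :
    (a ^ 2 + b) / T ^ 2 ≤ 5 * (a / T + (d + b ^ 3 + a ^ 6) / T ^ 2) ∧
      (a ^ 3 + a * b + d) / T ^ 2 ≤ 10 * (a / T + (d + b ^ 3 + a ^ 6) / T ^ 2) := by
  have hT0 : 0 < T := by linarith
  have hb3 : 0 ≤ b ^ 3 := by positivity
  have ha6 : 0 ≤ a ^ 6 := by positivity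
  have h1 : a ^ 3 ≤ a + a ^ 6 := by
    rcases le_total a 1 with h | h
    · have : a ^ 3 ≤ a := pow_le_of_le_one ha h (by norm_num)
      linarith
    · have : a ^ 3 ≤ a ^ 6 := pow_le_pow_right₀ h (by norm_num)
      linarith
  have h2 : a * b ≤ b + b ^ 3 + a ^ 6 := by
    rcases le_total a 1 with h | h
    · nlinarith
    · rcases le_total b 1 with h' | h'
      · have h3 : a ≤ a ^ 6 := le_self_pow₀ h (by norm_num)
        nlinarith
      · have h3 : a ^ 2 ≤ a ^ 6 := pow_le_pow_right₀ h (by norm_num)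
        have h4 : b ^ 2 ≤ b ^ 3 := pow_le_pow_right₀ h' (by norm_num)
        nlinarith [sq_nonneg (a - b)]
  have e : ∀ c, c * (a / T + (d + b ^ 3 + a ^ 6) / T ^ 2)
      = (c * (a * T + (d + b ^ 3 + a ^ 6))) / T ^ 2 := by
    intro c; field_simp
  have haTT : a ≤ a * T := le_mul_of_one_le_right ha hT
  have ha2 : a ^ 2 ≤ a * T := by nlinarith
  rw [e, e]
  constructor
  · refine div_le_div_of_nonneg_right ?_ (by positivity)
    linarith
  · refine div_le_div_of_nonneg_right ?_ (by positivity)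
    linarith

namespace GappedFamily

variable {N : ℕ} {a b d : ℝ} {H H₁ H₂ H₃ P R : ℝ → QOp N} {E e : ℝ → ℝ}

theorem landau (h : GappedFamily a b d H H₁ H₂ H₃ P R E e) :
    GappedFamily a (min b (4 * a + d)) d H H₁ H₂ H₃ P R E e :=
  { h with
    bound₂ := fun s hs => le_min (h.bound₂ s hs)
      (norm_deriv_le_of_norm_second_deriv_le h.deriv₁ h.deriv₂ h.bound₁ h.bound₃ s hs) }

/-- The adiabatic theorem for a Hamiltonian with a unit gap. -/
theorem norm_leakage_le (h : GappedFamily a b d H H₁ H₂ H₃ P R E e) {T : ℝ} (hT : 0 < T)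
    {U : ℝ → QOp N} (hU : IsEvolution T H U)
    (hH : ∀ s ∈ Icc (0 : ℝ) 1, IsSelfAdjoint (H s)) :
    ‖(1 - P 1) * (U 1 * P 0)‖ ≤ 10 ^ 32 * (a / T + (d + b ^ 3 + a ^ 6) / T ^ 2) := by
  obtain ⟨ha, hb, hd⟩ := h.nonneg
  have m0 : (0 : ℝ) ∈ Icc (0 : ℝ) 1 := ⟨le_rfl, zero_le_one⟩
  have m1 : (1 : ℝ) ∈ Icc (0 : ℝ) 1 := ⟨zero_le_one, le_rfl⟩
  have hP0 := h.norm_proj m0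
  have hP1 := h.norm_proj m1
  have hPP := h.proj_sq m1
  have hrest : 0 ≤ (d + b ^ 3 + a ^ 6) / T ^ 2 := by positivity
  have haT0 : 0 ≤ a / T := by positivity
  -- For `T < 1` the uncorrected `P` serves as the almost conserved family: its residual is `P'`, of
  -- norm at most `4 * a ≤ 4 * a / T`.
  rcases lt_or_ge T 1 with hT1 | hT1
  · have hF := hU.norm_conj_sub_le hH h.deriv_P (δ := 4 * a) (fun s hs => by
      rw [h.mul_proj s hs, h.proj_mul s hs, sub_self, smul_zero, add_zero]
      have h1 := h.jet_derivP (n := 0) (by norm_num) zero_le_one zero_le_one h.jet_P_zero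
        h.jet_R_zero h.jet_H₁.of_succ.of_succ s hs
      simp only [jetWeight] at h1
      linarith)
    have h1 := hU.norm_leakage_le hH hF hPP hP1.le (ρ := 0) (by simp) (by simp)
    have h2 : a ≤ a / T := by rw [le_div_iff₀ hT]; nlinarith
    linarith
  · rcases lt_or_ge T a with haT | haT
    -- Here `a / T` exceeds 1, and the leakage never exceeds 2.
    · have hone : ‖(1 : QOp N)‖ ≤ 1 := ContinuousLinearMap.norm_id_le
      have b0 : ‖1 - P 1‖ ≤ 2 := (norm_sub_le _ _).trans (by linarith)
      have b1 : ‖U 1 * P 0‖ ≤ 1 := (norm_mul_le _ _).trans (by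
        rw [hP0, mul_one]; exact hU.norm_le_one hH m1)
      have b2 : 1 ≤ a / T := by rw [le_div_iff₀ hT]; linarith
      calc _ ≤ ‖1 - P 1‖ * ‖U 1 * P 0‖ := norm_mul_le _ _
        _ ≤ 2 * 1 := mul_le_mul b0 b1 (norm_nonneg _) zero_le_two
        _ ≤ _ := by linarith
    · set b' := min b (4 * a + d) with hb'
      have h' := h.landau
      have hb'0 : 0 ≤ b' := h'.nonneg.2.1
      obtain ⟨F, F', hF, hFP, hres⟩ := h'.exists_superadiabatic hT
      have h1 := hU.norm_leakage_le hH (hU.norm_conj_sub_le hH hF hres) hPP hP1.le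
        (hFP 0 m0) (hFP 1 m1)
      have hab := jetWeight_absorb ha hb'0 hd hT1 haT (min_le_right b (4 * a + d))
      have hmono : (d + b' ^ 3 + a ^ 6) / T ^ 2 ≤ (d + b ^ 3 + a ^ 6) / T ^ 2 := by
        have : b' ≤ b := min_le_left _ _
        gcongr
      -- The constants add up to `2 * (2 * (1 + 5) + 10) = 44` times `10 ^ 30`.
      linarith [hab.1, hab.2]

end GappedFamily

/-! ### Derivative maxima, gaps, and the return to physical units. -/

namespace ThriceDifferentiable

variable {N : ℕ} {H : ℝ → QOp N}

theorem hasDerivWithinAt (hH : ThriceDifferentiable H) {k : ℕ} (hk : k < 3) {s : ℝ}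
    (hs : s ∈ Icc (0 : ℝ) 1) :
    HasDerivWithinAt (iteratedDerivWithin k H (Icc 0 1)) (iteratedDerivWithin (k + 1) H (Icc 0 1) s)
      (Icc 0 1) s := by
  rw [iteratedDerivWithin_succ]
  exact (hH.differentiableOn k hk s hs).hasDerivWithinAt

theorem norm_le_derivMax (hH : ThriceDifferentiable H) {k : ℕ} (hk : k ≤ 3) {s : ℝ}
    (hs : s ∈ Icc (0 : ℝ) 1) : ‖iteratedDerivWithin k H (Icc 0 1) s‖ ≤ derivMax k H := by
  refine le_csSup ?_ (mem_image_of_mem _ hs)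
  rcases hk.lt_or_eq with h | rfl
  · exact isCompact_Icc.bddAbove_image (hH.differentiableOn k h).continuousOn.norm
  · exact hH.bddAbove

theorem derivMax_nonneg (hH : ThriceDifferentiable H) {k : ℕ} (hk : k ≤ 3) : 0 ≤ derivMax k H :=
  (norm_nonneg _).trans (hH.norm_le_derivMax hk (s := 0) ⟨le_rfl, zero_le_one⟩)

end ThriceDifferentiable

namespace IsNondegenerateEigenstate

variable {N : ℕ} {H : ℝ → QOp N} {E : ℝ → ℝ} {G : ℝ → QState N}

theorem isEnergy (hG : IsNondegenerateEigenstate H E G) {s : ℝ} (hs : s ∈ Icc (0 : ℝ) 1) :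
    IsEnergy (H s) (E s) :=
  isEnergy_of_apply_eq (norm_ne_zero_iff.mp (by rw [hG.norm_eq_one s hs]; exact one_ne_zero))
    (hG.apply_eq s hs)

/-- An infimum over the empty set is 0, so `0 < gapMin H` yields two distinct eigenvalues at some
`s`. One of them differs from `E s`, so the set defining `gapFrom` is nonempty as well, and it is
contained in the one defining `gapMin`. -/
theorem gapMin_le_gapFrom (hG : IsNondegenerateEigenstate H E G) (h : 0 < gapMin H) :
    gapMin H ≤ gapFrom H E := by
  have hne : {d : ℝ | ∃ s ∈ Icc (0 : ℝ) 1, ∃ μ ν : ℝ,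
      IsEnergy (H s) μ ∧ IsEnergy (H s) ν ∧ μ ≠ ν ∧ d = |μ - ν|}.Nonempty := by
    by_contra hemp
    rw [not_nonempty_iff_eq_empty] at hemp
    rw [gapMin, hemp, Real.sInf_empty] at h
    exact lt_irrefl _ h
  refine le_csInf ?_ ?_
  · obtain ⟨d, s, hs, μ, ν, hμ, hν, hμν, -⟩ := hne
    by_cases hE : μ = E s
    · exact ⟨_, s, hs, ν, hν, fun h => hμν (hE.trans h.symm), rfl⟩
    · exact ⟨_, s, hs, μ, hμ, hE, rfl⟩
  · rintro d ⟨s, hs, μ, hμ, hne, rfl⟩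
    refine csInf_le ⟨0, ?_⟩ ⟨s, hs, μ, E s, hμ, hG.isEnergy hs, hne, rfl⟩
    rintro _ ⟨_, _, _, _, _, _, _, rfl⟩
    exact abs_nonneg _

theorem gapFrom_le {s : ℝ} (hs : s ∈ Icc (0 : ℝ) 1) {μ : ℝ} (hμ : IsEnergy (H s) μ)
    (hne : μ ≠ E s) : gapFrom H E ≤ |μ - E s| := by
  refine csInf_le ⟨0, ?_⟩ ⟨s, hs, μ, hμ, hne, rfl⟩
  rintro _ ⟨_, _, _, _, _, rfl⟩
  exact abs_nonneg _

end IsNondegenerateEigenstate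

/-- Changing the unit of energy and of the evolution time does not change the evolution. -/
theorem IsEvolution.rescale {N : ℕ} {T : ℝ} {H U : ℝ → QOp N} (hU : IsEvolution T H U) {γ : ℝ}
    (hγ : γ ≠ 0) : IsEvolution (γ * T) (fun s => ((γ⁻¹ : ℝ) : ℂ) • H s) U where
  init := hU.init
  hasDeriv s hs := by
    refine (hU.hasDeriv s hs).congr_deriv ?_
    have hc : (γ : ℂ) ≠ 0 := by exact_mod_cast hγ
    rw [smul_mul_assoc, smul_smul]
    congr 1
    push_cast
    field_simp

/-- The adiabatic theorem at a fixed evolution time, in terms of the gap around the energy. -/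
theorem norm_adiabaticError_le {N : ℕ} {T : ℝ} (hT : 0 < T) {H U : ℝ → QOp N} {E : ℝ → ℝ}
    {G : ℝ → QState N} (hsa : ∀ s ∈ Icc (0 : ℝ) 1, IsSelfAdjoint (H s))
    (hH : ThriceDifferentiable H) (hG : IsNondegenerateEigenstate H E G)
    (hU : IsEvolution T H U) {γ : ℝ} (hγ : 0 < γ)
    (hgap : ∀ s ∈ Icc (0 : ℝ) 1, ∀ μ : ℝ, IsEnergy (H s) μ → μ ≠ E s → γ ≤ |μ - E s|) :
    ‖adiabaticError U G‖ ≤ 10 ^ 32 * (derivMax 1 H / γ / (γ * T)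
      + (derivMax 3 H / γ + (derivMax 2 H / γ) ^ 3 + (derivMax 1 H / γ) ^ 6) / (γ * T) ^ 2) := by
  have hd : ∀ k < 3, ∀ s ∈ Icc (0 : ℝ) 1,
      HasDerivWithinAt (fun s => ((γ⁻¹ : ℝ) : ℂ) • iteratedDerivWithin k H (Icc 0 1) s)
        (((γ⁻¹ : ℝ) : ℂ) • iteratedDerivWithin (k + 1) H (Icc 0 1) s) (Icc 0 1) s := fun k hk s hs =>
    HasDerivWithinAt.fun_const_smul _ (hH.hasDerivWithinAt hk hs)
  have hb : ∀ k ≤ 3, ∀ s ∈ Icc (0 : ℝ) 1,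
      ‖((γ⁻¹ : ℝ) : ℂ) • iteratedDerivWithin k H (Icc 0 1) s‖ ≤ derivMax k H / γ := fun k hk s hs => by
    rw [norm_smul, Complex.norm_real, Real.norm_of_nonneg (inv_nonneg.mpr hγ.le), div_eq_inv_mul]
    exact mul_le_mul_of_nonneg_left (hH.norm_le_derivMax hk hs) (inv_nonneg.mpr hγ.le)
  have hsa' : ∀ s ∈ Icc (0 : ℝ) 1, IsSelfAdjoint (((γ⁻¹ : ℝ) : ℂ) • H s) := fun s hs =>
    IsSelfAdjoint.smul (Complex.conj_ofReal _) (hsa s hs)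
  have h0 : ∀ s ∈ Icc (0 : ℝ) 1,
      HasDerivWithinAt (fun s => ((γ⁻¹ : ℝ) : ℂ) • H s) (((γ⁻¹ : ℝ) : ℂ) • iteratedDerivWithin 1 H (Icc 0 1) s)
        (Icc 0 1) s := by
    simpa only [iteratedDerivWithin_zero] using hd 0 (by norm_num)
  have hγc : (γ : ℂ) ≠ 0 := by exact_mod_cast hγ.ne'
  -- The rescaled data are `H / γ` and `E / γ`; the lower bound for `H - E + γ P` divided by `γ` is
  -- the unit-gap hypothesis.
  obtain ⟨R, e, hfam⟩ := exists_gappedFamily (E := fun s => γ⁻¹ * E s) h0 (hd 1 (by norm_num))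
    (hd 2 (by norm_num)) (hb 1 (by norm_num)) (hb 2 (by norm_num)) (hb 3 le_rfl) hsa'
    (hG.continuousOn.const_mul _) hG.norm_eq_one
    (fun s hs => by
      change ((γ⁻¹ : ℝ) : ℂ) • H s (G s) = _
      rw [hG.apply_eq s hs, smul_smul]
      push_cast
      rfl)
    (fun s hs x => by
      have h1 := gap_mul_norm_le (hsa s hs) hγ.le (hG.norm_eq_one s hs) (hG.apply_eq s hs)
        (hG.nondegenerate s hs) (hgap s hs) x
      have h2 : (((γ⁻¹ : ℝ) : ℂ) • H s - ((γ⁻¹ * E s : ℝ) : ℂ) • (1 : QOp N) + stateProj (G s))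
          = ((γ⁻¹ : ℝ) : ℂ) • (H s - (E s : ℂ) • 1 + (γ : ℂ) • stateProj (G s)) := by
        rw [smul_add, smul_sub, smul_smul, smul_smul]
        push_cast
        rw [inv_mul_cancel₀ hγc, one_smul]
      rw [h2, smul_apply, norm_smul, Complex.norm_real,
        Real.norm_of_nonneg (inv_nonneg.mpr hγ.le), ← div_eq_inv_mul, le_div_iff₀ hγ, mul_comm]
      exact h1)
  have hG0 : ‖G 0‖ = 1 := hG.norm_eq_one 0 ⟨le_rfl, zero_le_one⟩
  have hle := hfam.norm_leakage_le (mul_pos hγ hT) (hU.rescale hγ.ne') hsa'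
  have herr : adiabaticError U G
      = ((1 - stateProj (G 1)) * (U 1 * stateProj (G 0))) (G 0) := by
    change _ = (1 - stateProj (G 1)) (U 1 (stateProj (G 0) (G 0)))
    rw [stateProj_apply_self hG0]
    rfl
  rw [herr]
  refine (ContinuousLinearMap.le_opNorm _ _).trans ?_
  rw [hG0, mul_one]
  exact hle

/-- With `g` the gap around `E`, the leading term is exactly the first term of `Δ₀/T`. Only in the
remainder is `g` lowered to the global gap `m`. -/
theorem adiabatic_bound_le {T a b d m g : ℝ} (hT : 0 < T) (ha : 0 ≤ a) (hb : 0 ≤ b) (hd : 0 ≤ d)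
    (hm : 0 < m) (hmg : m ≤ g) :
    a / g / (g * T) + (d / g + (b / g) ^ 3 + (a / g) ^ 6) / (g * T) ^ 2
      ≤ (a / g ^ 2 + 1 / m * (d / m + b ^ 3 / m ^ 3 + a ^ 6 / m ^ 6) / (m * T)) / T := by
  have hg : 0 < g := hm.trans_le hmg
  have e : (a / g ^ 2 + 1 / m * (d / m + b ^ 3 / m ^ 3 + a ^ 6 / m ^ 6) / (m * T)) / T
      = a / g / (g * T) + (d / m + (b / m) ^ 3 + (a / m) ^ 6) / (m * T) ^ 2 := by
    simp only [div_pow]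
    ring
  rw [e]
  gcongr

theorem le_timescale₀_div {N : ℕ} {T : ℝ} (hT : 0 < T) {H : ℝ → QOp N} {E : ℝ → ℝ}
    (hH : ThriceDifferentiable H) (hm : 0 < gapMin H) (hle : gapMin H ≤ gapFrom H E) :
    derivMax 1 H / gapFrom H E / (gapFrom H E * T)
      + (derivMax 3 H / gapFrom H E + (derivMax 2 H / gapFrom H E) ^ 3
        + (derivMax 1 H / gapFrom H E) ^ 6) / (gapFrom H E * T) ^ 2
      ≤ timescale₀ T H E / T := by
  rw [timescale₀, timescale₁]
  exact adiabatic_bound_le hT (hH.derivMax_nonneg (by norm_num)) (hH.derivMax_nonneg (by norm_num))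
    (hH.derivMax_nonneg le_rfl) hm hle

theorem theorem1 :
    ∃ C : ℝ, 0 < C ∧
      ∀ (N : ℕ) (H : ℝ → ℝ → QOp N) (E : ℝ → ℝ → ℝ) (G : ℝ → ℝ → QState N)
        (U : ℝ → ℝ → QOp N),
        (∀ T : ℝ, 0 < T → ∀ s ∈ Icc (0 : ℝ) 1, IsSelfAdjoint (H T s)) →
        (∀ T : ℝ, 0 < T → ThriceDifferentiable (H T)) →
        (∀ T : ℝ, 0 < T → 0 < gapMin (H T)) →
        (∀ T : ℝ, 0 < T → IsNondegenerateEigenstate (H T) (E T) (G T)) →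
        (∀ T : ℝ, 0 < T → IsEvolution T (H T) (U T)) →
        (fun T : ℝ => timescale₀ T (H T) (E T)) =o[atTop] (fun T : ℝ => T) →
        IsBigOWith C atTop (fun T : ℝ => adiabaticError (U T) (G T))
          (fun T : ℝ => timescale₀ T (H T) (E T) / T) := by
  refine ⟨10 ^ 32, by positivity, fun N H E G U hsa hH hgap hG hU _ => ?_⟩
  rw [isBigOWith_iff]
  filter_upwards [eventually_gt_atTop 0] with T hT
  have hle := (hG T hT).gapMin_le_gapFrom (hgap T hT)
  -- The unit of energy is `γ = gapFrom`, positive because it dominates `gapMin`.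
  refine (norm_adiabaticError_le hT (hsa T hT) (hH T hT) (hG T hT) (hU T hT)
    ((hgap T hT).trans_le hle) fun s hs μ hμ hne =>
      IsNondegenerateEigenstate.gapFrom_le hs hμ hne).trans ?_
  gcongr
  exact (le_timescale₀_div hT (hH T hT) (hgap T hT) hle).trans (Real.le_norm_self _)
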